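/- Everything is real-analytic. Let $\boldsymbol\eta=A(x)\,d\mathbf x$, $A:\mathbb R^n\to GL(n,\mathbb R)$, be a coframe on $\mathbb R^n$ and let $G\subset GL(n,\mathbb R)$ be an $r$-dimensional Lie subgroup. Let $\mathcal G_1=\{(x,X,g)\}=\mathbb R^n\times\mathbb R^n\times G$, where $(x,X,g)$ stands for the 1-jet with source $x$, target $X$ and Jacobian $A(X)^{-1}gA(x)$; along a map $\varphi$ with $\varphi^*\boldsymbol\eta=h\boldsymbol\eta$, $h(x)\in G$, it is $(x,\varphi(x),h(x))$. Let $\alpha^1,\dots,\alpha^r$ be a basis of the right-invariant 1-forms on $G$ and $dg\cdot g^{-1}=\sum_\kappa F_\kappa\alpha^\kappa$ with constant matrices $F_\kappa=(F^{ij}_\kappa)$. Define $B^i_{jk}$, $C^i_{jk}$ ($j<k$) by $d\eta^i=\sum_{j<k}B^i_{jk}(x)\,\eta^j\wedge\eta^k$ and $(g\,d\boldsymbol\eta)^i=\sum_{j<k}C^i_{jk}(x,g)(g\boldsymbol\eta)^j\wedge(g\boldsymbol\eta)^k$. The differential equation $\mathcal G_{1,1}$ consists of the 2-jets $(x,X,g,z)$,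 $z=(z^\kappa_j)\in\mathbb R^{rn}$, with $$B^i_{jk}(X)=\sum_\kappa\bigl(F^{ik}_\kappa z^\kappa_j-F^{ij}_\kappa z^\kappa_k\bigr)+C^i_{jk}(x,g)\qquad(j<k);\tag{1}$$ $j^2\varphi|_x=(x,\varphi(x),h,z)$ means that at $x$ one has $\varphi^*\boldsymbol\eta=h\boldsymbol\eta$ with $h\in G$ and $dh\cdot h^{-1}=\sum_\kappa F_\kappa\sum_jz^\kappa_j(h\boldsymbol\eta)^j$. A local diffeomorphism $\varphi$ solves $\mathcal G_{1,1}$ if its 2-jet at every point of its domain is of this form and satisfies (1). Assume there are no invariants: for some constants $k^i_{jk}$ the normalized equations $k^i_{jk}=\sum_\kappa(F^{ik}_\kappa z^\kappa_j-F^{ij}_\kappa z^\kappa_k)+C^i_{jk}(x,g)$ can be solved for $z$ over every $(x,g)$. Write their solution as $z=\mathbf Pz+\mathbf Qc(x,g)$, $c=C-k$, with constant matrices $\mathbf P,\mathbf Q$ with rows $P^\kappa_j,Q^\kappa_j$: for parametric $z^\kappa_j$ this is the identity $z^\kappa_j=z^\kappa_j$, and for principal $z^\kappa_j$ the right-hand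 side contains no principal variables. Let $r_2$ be the number of parametric $z^\kappa_j$. On $\mathcal G_1$ put $\pi^\kappa=\alpha^\kappa-\sum_j(Q^\kappa_j\cdot c(x,g))(g\boldsymbol\eta)^j$, and let $M(v)$ be the $r\times n$ matrix with entries $P^\kappa_j\cdot v$, $v\in\mathbb R^{rn}$. The prolonged equivalence problem asks for maps $\Phi$ from open subsets of $\mathcal G_1$ to $\mathcal G_1$ that fix the coordinate $X$ and satisfy $$\Phi^*\begin{bmatrix}g\boldsymbol\eta\\ \boldsymbol\pi\end{bmatrix}=\begin{bmatrix}I_n&0\\M(v)&I_r\end{bmatrix}\begin{bmatrix}g\boldsymbol\eta\\ \boldsymbol\pi\end{bmatrix}\tag{2}$$ for some $v$ (depending on the point). Let $R_{j^1\varphi}$ be the right groupoid action $j^1\psi|_x\mapsto j^1\psi|_x\cdot j^1\varphi^{-1}|_{\varphi(x)}$, i.e. $(x,X,g)\mapsto(\varphi(x),X,gh(x)^{-1})$. **Theorem.** The differential equation $\mathcal G_{1,1}$ is equivalent to the prolonged equivalence problem (2), which is that of a $G^{(2)}$-structure with $G^{(2)}$ abelian. Precisely: 1. $g\boldsymbol\eta,\boldsymbol\pi$,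 together with $d\mathbf X$, form a coframe on $\mathcal G_1$. The fibre of $\mathcal G_{1,1}$ over each point of $\mathcal G_1$ is a non-empty affine space of dimension $r_2$. The matrices in (2) form an abelian group $G^{(2)}$, multiplied by adding the vectors $v$, and the entries $M(v)^\kappa_j$ with $z^\kappa_j$ parametric give an isomorphism of topological groups $G^{(2)}\cong\mathbb R^{r_2}$. 2. (Jets.) Let $p=(x,X,g)$, $q=(X',\cdot,\cdot)\in\mathcal G_1$ and let $L:T_p\mathcal G_1\to T_q\mathcal G_1$ be linear. The 1-jet $(p,q,L)$ of maps $\mathcal G_1\to\mathcal G_1$ satisfies (2) and fixes $X$ if and only if it is the 1-jet at $p$ of the right action determined by a 2-jet $(x,X',h,z)\in\mathcal G_{1,1}$, that is, $q=(X',X,gh^{-1})$, and $L$ covers the linear map $A(X')^{-1}hA(x)$ on the source coordinates, fixes $dX$, and pulls $dg\cdot g^{-1}$ back to $dg\cdot g^{-1}-(gh^{-1})\bigl(\sum_{\kappa,j}F_\kappa z^\kappa_j(h\boldsymbol\eta)^j\bigr)(gh^{-1})^{-1}$. This 2-jet is then unique. 3. (Solutions.) Let $W\subset\mathcal G_1$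 be open and $\Phi:W\to\mathcal G_1$ analytic. Then $\Phi$ solves the prolonged problem if and only if near every point of $W$ it equals $R_{j^1\varphi}$ for some local diffeomorphism $\varphi$ that solves $\mathcal G_{1,1}$. If the fibres of $W$ over the source coordinate $x$ are connected, this holds with a single $\varphi$ on the projection of $W$ to the source. 4. (Converse.) For every local diffeomorphism $\varphi$ on an open set $U$ that solves $\mathcal G_{1,1}$, $R_{j^1\varphi}$ is a local diffeomorphism of $U\times\mathbb R^n\times G$ into $\mathcal G_1$ that solves the prolonged problem, and its 1-jets are those determined in the sense of 2 by the 2-jets of $\varphi$. -/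

import Mathlib

open scoped Manifold ContDiff Topology Matrix

noncomputable section

namespace CartanProlongation

/-- `ℝⁿ`. -/
abbrev E (n : ℕ) : Type := EuclideanSpace ℝ (Fin n)

/-- `e_j`, the standard basis of `ℝⁿ`. -/
abbrev e {n : ℕ} (j : Fin n) : E n := EuclideanSpace.single j 1

/-- Index set of the components `T^i_{jk}`, `j < k`, of an `ℝⁿ`-valued 2-form on `ℝⁿ`. -/
abbrev TIdx (n : ℕ) : Type := Fin n × {q : Fin n × Fin n // q.1 < q.2}

/-- The space `𝒢₁` in its coordinates `(x, X, g)`: the point `(x, X, g)` is the 1-jet with source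
`x`, target `X` and Jacobian matrix `A(X)⁻¹ g A(x)`, see `jacobian`. -/
abbrev G1 (n : ℕ) (G : Type*) : Type _ := E n × E n × G

/-- The model with corners of the manifold `𝒢₁ = ℝⁿ × ℝⁿ × G`. -/
abbrev I1 (n r : ℕ) := 𝓘(ℝ, E n).prod (𝓘(ℝ, E n).prod (𝓡 r))

/-- The tangent space of `𝒢₁` at any point, `(dx, dX, dg)` being the three components. -/
abbrev T1 (n r : ℕ) : Type := E n × E n × E r

variable {n r : ℕ} {G : Type*} [TopologicalSpace G] [ChartedSpace (E r) G] [Group G]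

/-- The element of `G` as a linear endomorphism of `ℝⁿ`. -/
def toEnd (ι : G →* (E n ≃L[ℝ] E n)) (g : G) : E n →L[ℝ] E n := (ι g : E n →L[ℝ] E n)

/-- `ι` makes the `r`-dimensional (real-analytic) Lie group `G` a Lie subgroup of `GL(n, ℝ)`:
it is an injective homomorphism and an analytic immersion. -/
structure IsLieSubgroup (ι : G →* (E n ≃L[ℝ] E n)) : Prop where
  injective : Function.Injective ι
  analytic : ContMDiff (𝓡 r) 𝓘(ℝ, E n →L[ℝ] E n) ω (toEnd ι)
  immersive : ∀ g : G, Function.Injective (mfderiv (𝓡 r) 𝓘(ℝ, E n →L[ℝ] E n) (toEnd ι) g)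

/-- The right-invariant 1-forms `α^κ` on `G` given by the basis `b` of the Lie algebra: `α^κ` is
the right-invariant form which at the identity is the `κ`-th coordinate with respect to `b`. -/
def alpha (b : Module.Basis (Fin r) ℝ (GroupLieAlgebra (𝓡 r) G)) (κ : Fin r) (g : G)
    (w : TangentSpace (𝓡 r) g) : ℝ :=
  b.repr (mfderiv (𝓡 r) (𝓡 r) (fun a : G => a * g⁻¹) g w) κ

/-- The constant matrices `F_κ` with `dg·g⁻¹ = ∑_κ F_κ α^κ`. -/
def F (ι : G →* (E n ≃L[ℝ] E n)) (b : Module.Basis (Fin r) ℝ (GroupLieAlgebra (𝓡 r) G))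
    (κ : Fin r) : E n →L[ℝ] E n :=
  mfderiv (𝓡 r) 𝓘(ℝ, E n →L[ℝ] E n) (toEnd ι) (1 : G) (b κ)

/-- The coframe `η = A(x) dx` as an `ℝⁿ`-valued 1-form on `ℝⁿ`. -/
def eta (A : E n → E n ≃L[ℝ] E n) (x : E n) : E n [⋀^Fin 1]→L[ℝ] E n :=
  ContinuousAlternatingMap.ofSubsingleton ℝ (E n) (E n) (0 : Fin 1) (A x : E n →L[ℝ] E n)

/-- The structure functions `B^i_{jk}` of `η`: `dη^i = ∑_{j<k} B^i_{jk} η^j ∧ η^k`, i.e. the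
values of `dη` on the frame dual to `η`. -/
def B (A : E n → E n ≃L[ℝ] E n) (x : E n) (t : TIdx n) : ℝ :=
  extDeriv (eta A) x ![(A x).symm (e t.2.1.1), (A x).symm (e t.2.1.2)] t.1

/-- The functions `C^i_{jk}(x, g)`: `(g dη)^i = ∑_{j<k} C^i_{jk}(x, g) (gη)^j ∧ (gη)^k`, i.e. the
values of `g dη` on the frame dual to `gη`. -/
def C (ι : G →* (E n ≃L[ℝ] E n)) (A : E n → E n ≃L[ℝ] E n) (x : E n) (g : G) (t : TIdx n) : ℝ :=
  ι g (extDeriv (eta A) x ![(A x).symm ((ι g).symm (e t.2.1.1)),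
    (A x).symm ((ι g).symm (e t.2.1.2))]) t.1

/-- The expressions `∑_κ (F^{ik}_κ z^κ_j - F^{ij}_κ z^κ_k)`, `j < k`. -/
def linTorsion (ι : G →* (E n ≃L[ℝ] E n)) (b : Module.Basis (Fin r) ℝ (GroupLieAlgebra (𝓡 r) G))
    (z : Fin r × Fin n → ℝ) (t : TIdx n) : ℝ :=
  ∑ κ, (F ι b κ (e t.2.1.2) t.1 * z (κ, t.2.1.1) - F ι b κ (e t.2.1.1) t.1 * z (κ, t.2.1.2))

/-- The second order equations of `𝒢₁,₁` at the point `(x, X, g, z)`: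
`B^i_{jk}(X) = ∑_κ (F^{ik}_κ z^κ_j - F^{ij}_κ z^κ_k) + C^i_{jk}(x, g)`. -/
def SecondOrderEq (ι : G →* (E n ≃L[ℝ] E n)) (A : E n → E n ≃L[ℝ] E n)
    (b : Module.Basis (Fin r) ℝ (GroupLieAlgebra (𝓡 r) G))
    (x X : E n) (g : G) (z : Fin r × Fin n → ℝ) : Prop :=
  ∀ t : TIdx n, B A X t = linTorsion ι b z t + C ι A x g t

/-- The matrix `A(φ(x)) ∇φ(x) A(x)⁻¹`, which is `g` when `φ^*η = gη`. -/
def cartanMatrix (A : E n → E n ≃L[ℝ] E n) (φ : E n → E n) (x : E n) : E n →L[ℝ] E n :=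
  (A (φ x) : E n →L[ℝ] E n) ∘L fderiv ℝ φ x ∘L ((A x).symm : E n →L[ℝ] E n)

/-- `j²φ|ₓ = (x, φ(x), h, z)` in the coordinates `(x, X, g, z)`: at `x` we have `φ^*η = hη` with
`h ∈ G`, and the `α^κ` pull back to `z^κ_j (hη)^j`, i.e. `dh·h⁻¹ = ∑_κ F_κ ∑_j z^κ_j (hη)^j`. -/
def HasSecondJet (ι : G →* (E n ≃L[ℝ] E n)) (A : E n → E n ≃L[ℝ] E n)
    (b : Module.Basis (Fin r) ℝ (GroupLieAlgebra (𝓡 r) G))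
    (φ : E n → E n) (x : E n) (h : G) (z : Fin r × Fin n → ℝ) : Prop :=
  (∀ u, A (φ x) (fderiv ℝ φ x u) = ι h (A x u)) ∧
  ∀ u, fderiv ℝ (cartanMatrix A φ) x u =
    (∑ κ, (∑ j, z (κ, j) * (ι h (A x u)) j) • F ι b κ) ∘L toEnd ι h

/-- `φ` is a solution on `U` of the differential equation `𝒢₁,₁`: the 2-jet of `φ` at each point of
`U` satisfies `φ^*η = gη`, `g ∈ G`, and the second order equations. -/
def SolvesG11 (ι : G →* (E n ≃L[ℝ] E n)) (A : E n → E n ≃L[ℝ] E n)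
    (b : Module.Basis (Fin r) ℝ (GroupLieAlgebra (𝓡 r) G))
    (φ : E n → E n) (U : Set (E n)) : Prop :=
  ∀ x ∈ U, ∃ (h : G) (z : Fin r × Fin n → ℝ),
    HasSecondJet ι A b φ x h z ∧ SecondOrderEq ι A b x (φ x) h z

/-- The Jacobian matrix `A(X)⁻¹ g A(x)` of the 1-jet `(x, X, g)`. -/
def jacobian (ι : G →* (E n ≃L[ℝ] E n)) (A : E n → E n ≃L[ℝ] E n) (p : G1 n G) :
    E n →L[ℝ] E n :=
  ((A p.2.1).symm : E n →L[ℝ] E n) ∘L toEnd ι p.2.2 ∘L (A p.1 : E n →L[ℝ] E n)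

/-- `q = R_{j¹φ} · p`, where `R` is the right groupoid action
`R_{j¹φ} · j¹ψ|ₓ = j¹ψ|ₓ · j¹φ⁻¹|_{φ(x)}`: the source of `q` is `φ(x)`, its target is that of `p`,
and its Jacobian composed with that of `φ` at `x` is the Jacobian of `p`.
In coordinates, `R_{j¹φ} · (x, X, g) = (φ(x), X, g h⁻¹)` where `φ^*η = hη` at `x`. -/
def IsRightAction (ι : G →* (E n ≃L[ℝ] E n)) (A : E n → E n ≃L[ℝ] E n) (φ : E n → E n)
    (p q : G1 n G) : Prop :=
  q.1 = φ p.1 ∧ q.2.1 = p.2.1 ∧ jacobian ι A q ∘L fderiv ℝ φ p.1 = jacobian ι A p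

/-- The forms `gη` on `𝒢₁`. -/
def gEta (ι : G →* (E n ≃L[ℝ] E n)) (A : E n → E n ≃L[ℝ] E n) (p : G1 n G) (w : T1 n r) : E n :=
  ι p.2.2 (A p.1 w.1)

/-- A solution of the normalized equations `const = ∑_κ (F^{ik}_κ z^κ_j - F^{ij}_κ z^κ_k) + C^i_{jk}`
(no invariants being present, they are solvable over every `(x, g)`), in the form
`z = P z + Q c`, `c = C(x, g) - const`, with constant matrices `P` and `Q`. For parametric
`z^κ_j` the equation reads `z^κ_j = z^κ_j`; for principal ones the right-hand side contains no
principal variables. -/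
structure Absorption (ι : G →* (E n ≃L[ℝ] E n)) (A : E n → E n ≃L[ℝ] E n)
    (b : Module.Basis (Fin r) ℝ (GroupLieAlgebra (𝓡 r) G)) where
  /-- the parametric variables `z^κ_j`; the other ones are principal -/
  par : Finset (Fin r × Fin n)
  /-- the constants -/
  const : TIdx n → ℝ
  P : Matrix (Fin r × Fin n) (Fin r × Fin n) ℝ
  Q : Matrix (Fin r × Fin n) (TIdx n) ℝ
  P_parametric : ∀ a ∈ par, P a = Pi.single a 1
  Q_parametric : ∀ a ∈ par, Q a = 0
  P_principal : ∀ a ∉ par, ∀ a' ∉ par, P a a' = 0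
  solved : ∀ (x : E n) (g : G) (z : Fin r × Fin n → ℝ),
    (∀ t, const t = linTorsion ι b z t + C ι A x g t) ↔ z = P *ᵥ z + Q *ᵥ (C ι A x g - const)

namespace Absorption

variable {ι : G →* (E n ≃L[ℝ] E n)} {A : E n → E n ≃L[ℝ] E n}
  {b : Module.Basis (Fin r) ℝ (GroupLieAlgebra (𝓡 r) G)} (D : Absorption ι A b)

/-- The forms `π^κ = α^κ - (Q^κ_j · c(x, g)) (gη)^j` on `𝒢₁`. -/
def piForm (p : G1 n G) (w : T1 n r) (κ : Fin r) : ℝ :=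
  alpha b κ p.2.2 w.2.2 - ∑ j, (D.Q *ᵥ (C ι A p.1 p.2.2 - D.const)) (κ, j) * gEta ι A p w j

/-- The column vector `(gη, π)`. -/
def coframe (p : G1 n G) (w : T1 n r) : Fin n ⊕ Fin r → ℝ :=
  Sum.elim (fun j => gEta ι A p w j) (D.piForm p w)

/-- The `r × n` matrix `M(v)` with entries `P^κ_j · v`. -/
def M (v : Fin r × Fin n → ℝ) : Matrix (Fin r) (Fin n) ℝ :=
  Matrix.of fun κ j => (D.P *ᵥ v) (κ, j)

/-- The matrix `[[I, 0], [M(v), I]]`. -/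
def block (v : Fin r × Fin n → ℝ) : Matrix (Fin n ⊕ Fin r) (Fin n ⊕ Fin r) ℝ :=
  Matrix.fromBlocks 1 0 (D.M v) 1

theorem block_mul (v y : Fin r × Fin n → ℝ) : D.block v * D.block y = D.block (v + y) := by
  have h : D.M v + D.M y = D.M (v + y) := by
    ext κ j
    simp [M, Matrix.mulVec_add]
  simp [block, Matrix.fromBlocks_multiply, h]

theorem block_zero : D.block 0 = 1 := by
  have h : D.M 0 = 0 := by
    ext κ j
    simp [M]
  simp [block, h, Matrix.fromBlocks_one]

/-- The group `G⁽²⁾` of the matrices `[[I, 0], [M(v), I]]`. -/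
def G2 : Subgroup (GL (Fin n ⊕ Fin r) ℝ) where
  carrier := {m | ∃ v, (m : Matrix (Fin n ⊕ Fin r) (Fin n ⊕ Fin r) ℝ) = D.block v}
  one_mem' := ⟨0, by simp [block_zero]⟩
  mul_mem' := by
    rintro m m' ⟨v, hv⟩ ⟨y, hy⟩
    exact ⟨v + y, by rw [Units.val_mul, hv, hy, block_mul]⟩
  inv_mem' := by
    rintro m ⟨v, hv⟩
    refine ⟨-v, ?_⟩
    have h : (m : Matrix (Fin n ⊕ Fin r) (Fin n ⊕ Fin r) ℝ) * D.block (-v) = 1 := by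
      rw [hv, block_mul, add_neg_cancel, block_zero]
    exact Units.inv_eq_of_mul_eq_one_right h

/-- The equations of the prolonged equivalence problem on a 1-jet of maps `𝒢₁ → 𝒢₁` with source
`p`, target `q` and linear part `L`: the coordinate `X` is fixed, and
`Φ^*(gη, π) = [[I, 0], [M(v), I]] (gη, π)` for some element of `G⁽²⁾`. -/
def ProlongedAt (p q : G1 n G) (L : T1 n r →L[ℝ] T1 n r) : Prop :=
  (q.2.1 = p.2.1 ∧ ∀ w, (L w).2.1 = w.2.1) ∧
  ∃ m ∈ D.G2, ∀ w, D.coframe q (L w) =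
    (m : Matrix (Fin n ⊕ Fin r) (Fin n ⊕ Fin r) ℝ) *ᵥ D.coframe p w

/-- `Φ` is a solution on `W ⊆ 𝒢₁` of the prolonged equivalence problem. -/
def SolvesProlonged (Φ : G1 n G → G1 n G) (W : Set (G1 n G)) : Prop :=
  ∀ p ∈ W, D.ProlongedAt p (Φ p) (mfderiv (I1 n r) (I1 n r) Φ p)

end Absorption

/-- The 1-jet `(p, q, L)` of maps `𝒢₁ → 𝒢₁` is that of the right action `(x, X, g) ↦ (φ(x), X, g h(x)⁻¹)`
of `j¹φ` at `p = (x, X, g)`, for a 2-jet `j²φ|ₓ = (x, X', h, z)`: with `dh·h⁻¹ = ∑_κ F_κ z^κ_j (hη)^j`,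
it pulls `dg·g⁻¹` back to `dg·g⁻¹ - (gh⁻¹)(dh·h⁻¹)(gh⁻¹)⁻¹`. -/
def IsActionJet (ι : G →* (E n ≃L[ℝ] E n)) (A : E n → E n ≃L[ℝ] E n)
    (b : Module.Basis (Fin r) ℝ (GroupLieAlgebra (𝓡 r) G))
    (X' : E n) (h : G) (z : Fin r × Fin n → ℝ)
    (p q : G1 n G) (L : T1 n r →L[ℝ] T1 n r) : Prop :=
  q = (X', p.2.1, p.2.2 * h⁻¹) ∧
  ∀ w, A X' (L w).1 = ι h (A p.1 w.1) ∧ (L w).2.1 = w.2.1 ∧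
    ∑ κ, alpha b κ q.2.2 (L w).2.2 • F ι b κ =
      ∑ κ, alpha b κ p.2.2 w.2.2 • F ι b κ -
        toEnd ι (p.2.2 * h⁻¹) ∘L (∑ κ, (∑ j, z (κ, j) * (ι h (A p.1 w.1)) j) • F ι b κ) ∘L
          toEnd ι (p.2.2 * h⁻¹)⁻¹

end CartanProlongation

end

open CartanProlongation

/-! Jets. Since `π` is `α` minus a multiple of `gη`, the equations (2) on a linear map `L` from `p`
to `q` amount to two conditions: `gη` is preserved, and `dg·g⁻¹` pulls back to `dg·g⁻¹ - ∑ F_κ y^κ_j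
(gη)^j` with `y = Qc(p) - Qc(q) - Pv` (`coframe_eq_block_iff`). The jet of a right action with data
`(h, z)` has exactly this shape, with `y` the image of `z` under `Ad(gh⁻¹)`. Hence the group
coordinate of `q` determines `h`, and `y` determines `z`. What remains is to see that `y` has the
required form for some `v` precisely when `z` satisfies (1). The vector `Qc` is a particular
solution of the inhomogeneous linear equations and the image of `P` is the kernel of their linear
part, so the form of `y` means `C(q) = linTorsion y + C(p)` (`exists_P_eq_iff`). This is an identity
of alternating 2-forms, equivariant under `G`; removing the group element of `q` turns `C(q)` into
`B` and leaves (1) (`forall_C_eq_iff_secondOrderEq`). Together these give `prolongedAt_iff`.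

Solutions. Preservation of `gη` forces the source of `Φ` to be constant along the fibres over `x`,
so `Φ` locally covers a map `φ`. The same equation says `φ^*η = hη` with `h` the quotient of the
group coordinates, hence `Φ` is the right action of `j¹φ`. Differentiating the relation between
group coordinates and the Cartan matrix of `φ` matches the jets of `Φ` with the 2-jets of `φ`
(`deriv_of_isRightAction`). Connected fibres allow the local maps `φ` to be glued.

Converse. The delicate point is that `h` is analytic as a map into `G`, although `G` is only
immersed in `GL(n, ℝ)` and may carry a finer topology. The 2-jets make the Cartan matrix tangent to
the right-invariant distribution of the Lie algebra, so it stays in one leaf; this is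
`exists_factorization`. -/

open scoped Manifold ContDiff Topology Matrix

noncomputable section

namespace CartanProlongation

/-! ### The Maurer-Cartan form and the adjoint action -/

section MaurerCartan

set_option linter.unusedSectionVars false

variable {n r : ℕ} {G : Type*} [TopologicalSpace G] [ChartedSpace (E r) G] [Group G]
  [LieGroup (𝓡 r) ω G] {ι : G →* (E n ≃L[ℝ] E n)}
  (b : Module.Basis (Fin r) ℝ (GroupLieAlgebra (𝓡 r) G))

theorem toEnd_mul (ι : G →* (E n ≃L[ℝ] E n)) (g h : G) :
    toEnd ι (g * h) = toEnd ι g ∘L toEnd ι h := by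
  ext u; simp [toEnd]

theorem toEnd_one (ι : G →* (E n ≃L[ℝ] E n)) : toEnd ι 1 = ContinuousLinearMap.id ℝ (E n) := by
  ext u; simp [toEnd]

theorem toEnd_apply (ι : G →* (E n ≃L[ℝ] E n)) (g : G) (u : E n) : toEnd ι g u = ι g u := rfl

theorem apply_inv_apply (ι : G →* (E n ≃L[ℝ] E n)) (g : G) (u : E n) : ι g (ι g⁻¹ u) = u := by
  have h := toEnd_mul ι g g⁻¹
  rw [mul_inv_cancel, toEnd_one] at h
  exact (DFunLike.congr_fun h u).symm

theorem inv_apply_apply (ι : G →* (E n ≃L[ℝ] E n)) (g : G) (u : E n) : ι g⁻¹ (ι g u) = u := by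
  simpa using apply_inv_apply ι g⁻¹ u

theorem toEnd_injective (hι : IsLieSubgroup (r := r) ι) : Function.Injective (toEnd ι) :=
  fun _ _ h => hι.injective (ContinuousLinearEquiv.coe_injective h)

/-- The forms `α^κ` at `g` as a linear map. -/
def alphaLin (g : G) : E r →ₗ[ℝ] (Fin r → ℝ) :=
  (b.equivFun : GroupLieAlgebra (𝓡 r) G →ₗ[ℝ] (Fin r → ℝ)) ∘ₗ
    ContinuousLinearMap.toLinearMap (M := E r) (M₂ := E r)
      (mfderiv (𝓡 r) (𝓡 r) (fun a : G => a * g⁻¹) g)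

theorem alphaLin_apply (g : G) (w : E r) (κ : Fin r) : alphaLin b g w κ = alpha b κ g w := rfl

theorem mdifferentiableAt_mul_right (h g : G) :
    MDifferentiableAt (𝓡 r) (𝓡 r) (fun a : G => a * h) g :=
  (contMDiff_mul_right (I := 𝓡 r) (n := ω) (a := h)).mdifferentiable (by simp) g

/-- Right translation by `g` inverts right translation by `g⁻¹`, so the differential of the latter
has a left inverse. -/
theorem alphaLin_injective (g : G) : Function.Injective (alphaLin b g) := by
  refine b.equivFun.injective.comp ?_
  have h : mfderiv (𝓡 r) (𝓡 r) ((fun a : G => a * g) ∘ fun a : G => a * g⁻¹) g =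
      (mfderiv (𝓡 r) (𝓡 r) (fun a : G => a * g) (g * g⁻¹)).comp
        (mfderiv (𝓡 r) (𝓡 r) (fun a : G => a * g⁻¹) g) :=
    mfderiv_comp g (mdifferentiableAt_mul_right g _) (mdifferentiableAt_mul_right g⁻¹ g)
  have h' : ((fun a : G => a * g) ∘ fun a : G => a * g⁻¹) = id := by
    funext a; simp
  rw [h', mfderiv_id] at h
  intro w w' (hw : _ = _)
  have h1 := congrArg (mfderiv (𝓡 r) (𝓡 r) (fun a : G => a * g) (g * g⁻¹) : E r →L[ℝ] E r) hw
  have h2 : ∀ w : E r, (mfderiv (𝓡 r) (𝓡 r) (fun a : G => a * g) (g * g⁻¹) : E r →L[ℝ] E r)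
      ((mfderiv (𝓡 r) (𝓡 r) (fun a : G => a * g⁻¹) g : E r →L[ℝ] E r) w) = w :=
    fun w => (DFunLike.congr_fun h w).symm
  have h3 := (h2 w).symm.trans (h1.trans (h2 w'))
  exact h3

theorem alphaLin_bijective (g : G) : Function.Bijective (alphaLin b g) :=
  ⟨alphaLin_injective b g, (LinearMap.injective_iff_surjective_of_finrank_eq_finrank
    (by simp)).1 (alphaLin_injective b g)⟩

theorem mdifferentiable_toEnd (hι : IsLieSubgroup (r := r) ι) :
    MDifferentiable (𝓡 r) 𝓘(ℝ, E n →L[ℝ] E n) (toEnd ι) :=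
  hι.analytic.mdifferentiable (by simp)

/-- The derivative of `ι` at the identity, in terms of the basis `b`. -/
theorem mfderiv_toEnd_one (v : GroupLieAlgebra (𝓡 r) G) :
    mfderiv (𝓡 r) 𝓘(ℝ, E n →L[ℝ] E n) (toEnd ι) (1 : G) v = ∑ κ, b.repr v κ • F ι b κ := by
  conv_lhs => rw [← b.sum_repr v]
  rw [map_sum]
  refine Finset.sum_congr rfl fun κ _ => ?_
  rw [map_smul]
  rfl

/-- The Maurer-Cartan identity `dg = (∑ F_κ α^κ) g`. -/
theorem mfderiv_toEnd (hι : IsLieSubgroup (r := r) ι) (g : G) (w : E r) :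
    (mfderiv (𝓡 r) 𝓘(ℝ, E n →L[ℝ] E n) (toEnd ι) g : E r →L[ℝ] (E n →L[ℝ] E n)) w =
      (∑ κ, alpha b κ g w • F ι b κ) ∘L toEnd ι g := by
  -- Translate to the identity, apply `ι`, translate back: the chain rule reduces the claim to the
  -- derivative of `ι` at `1`.
  have h1 : toEnd ι = (fun T : E n →L[ℝ] E n => T ∘L toEnd ι g) ∘
      (toEnd ι ∘ fun a : G => a * g⁻¹) := by
    funext a
    simp [← toEnd_mul]
  have hR : HasFDerivAt (fun T : E n →L[ℝ] E n => T ∘L toEnd ι g)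
      ((ContinuousLinearMap.compL ℝ (E n) (E n) (E n)).flip (toEnd ι g))
        (toEnd ι (g * g⁻¹)) :=
    ((ContinuousLinearMap.compL ℝ (E n) (E n) (E n)).flip (toEnd ι g)).hasFDerivAt
  have h2 : HasMFDerivAt (𝓡 r) 𝓘(ℝ, E n →L[ℝ] E n) (toEnd ι ∘ fun a : G => a * g⁻¹) g
      ((mfderiv (𝓡 r) 𝓘(ℝ, E n →L[ℝ] E n) (toEnd ι) (g * g⁻¹)).comp
        (mfderiv (𝓡 r) (𝓡 r) (fun a : G => a * g⁻¹) g)) :=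
    HasMFDerivAt.comp g (mdifferentiable_toEnd hι _).hasMFDerivAt
      (mdifferentiableAt_mul_right g⁻¹ g).hasMFDerivAt
  have h3 := (HasMFDerivAt.comp g (I' := 𝓘(ℝ, E n →L[ℝ] E n))
    (hg := hR.hasMFDerivAt) (hf := h2)).mfderiv
  rw [← h1] at h3
  have h4 := DFunLike.congr_fun h3 w
  refine h4.trans ?_
  have h5 : ∀ (a : G) (ha : a = 1) (v : E r),
      (mfderiv (𝓡 r) 𝓘(ℝ, E n →L[ℝ] E n) (toEnd ι) a : E r →L[ℝ] (E n →L[ℝ] E n)) v =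
        ∑ κ, b.repr v κ • F ι b κ := by
    rintro a rfl v
    exact mfderiv_toEnd_one b v
  exact congrArg (fun T : E n →L[ℝ] E n => T ∘L toEnd ι g) (h5 _ (mul_inv_cancel g) _)

/-- The `F_κ` are the images of a basis under the derivative of an immersion. This is what allows
passage between identities for the `α^κ` and identities for `dg·g⁻¹`. -/
theorem F_linearIndependent (hι : IsLieSubgroup (r := r) ι) :
    LinearIndependent ℝ (F ι b) := by
  have h := b.linearIndependent.map'
    (ContinuousLinearMap.toLinearMap (M := E r) (M₂ := E n →L[ℝ] E n)
      (mfderiv (𝓡 r) 𝓘(ℝ, E n →L[ℝ] E n) (toEnd ι) (1 : G))) (LinearMap.ker_eq_bot.2 (hι.immersive 1))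
  exact h

theorem sum_smul_F_injective (hι : IsLieSubgroup (r := r) ι) {a a' : Fin r → ℝ}
    (h : ∑ κ, a κ • F ι b κ = ∑ κ, a' κ • F ι b κ) : a = a' := by
  have := Fintype.linearIndependent_iff.1 (F_linearIndependent b hι) (a - a')
    (by simp [sub_smul, Finset.sum_sub_distrib, h])
  funext κ
  exact sub_eq_zero.1 (this κ)

/-- `Ad(g)` preserves the Lie algebra, the span of the `F_κ`. -/
theorem exists_conj_F (hι : IsLieSubgroup (r := r) ι) (g : G) :
    ∃ a : Matrix (Fin r) (Fin r) ℝ, ∀ κ,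
      toEnd ι g ∘L F ι b κ ∘L toEnd ι g⁻¹ = ∑ κ', a κ κ' • F ι b κ' := by
  -- The derivative at `1` of `a ↦ ι(g a g⁻¹)` is computed in two ways: through `G`, where it lands
  -- in the Lie algebra, and through matrices, where it is conjugation.
  let cj : G → G := fun a => g * a * g⁻¹
  have hcj : MDifferentiableAt (𝓡 r) (𝓡 r) cj 1 :=
    ((contMDiff_mul_right (I := 𝓡 r) (n := ω) (a := g⁻¹)).comp
      (contMDiff_mul_left (I := 𝓡 r) (n := ω) (a := g))).mdifferentiable (by simp) 1
  have h2 : HasMFDerivAt (𝓡 r) 𝓘(ℝ, E n →L[ℝ] E n) (toEnd ι ∘ cj) 1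
      ((mfderiv (𝓡 r) 𝓘(ℝ, E n →L[ℝ] E n) (toEnd ι) (cj 1)).comp
        (mfderiv (𝓡 r) (𝓡 r) cj 1)) :=
    HasMFDerivAt.comp 1 (mdifferentiable_toEnd hι _).hasMFDerivAt hcj.hasMFDerivAt
  let R : (E n →L[ℝ] E n) →L[ℝ] (E n →L[ℝ] E n) :=
    (ContinuousLinearMap.compL ℝ (E n) (E n) (E n) (toEnd ι g)) ∘L
      ((ContinuousLinearMap.compL ℝ (E n) (E n) (E n)).flip (toEnd ι g⁻¹))
  have h3 := (HasMFDerivAt.comp (1 : G) (I' := 𝓘(ℝ, E n →L[ℝ] E n))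
    (hg := (R.hasFDerivAt (x := toEnd ι (1 : G))).hasMFDerivAt)
    (hf := (mdifferentiable_toEnd hι (1 : G)).hasMFDerivAt)).mfderiv
  have h1 : toEnd ι ∘ cj = R ∘ toEnd ι := by
    funext a
    simp [cj, R, toEnd_mul, ContinuousLinearMap.comp_assoc]
  rw [← h1, h2.mfderiv] at h3
  refine ⟨Matrix.of fun κ κ' => alpha b κ' (cj 1)
    ((mfderiv (𝓡 r) (𝓡 r) cj 1 : E r →L[ℝ] E r) (b κ)), fun κ => ?_⟩
  have h4 := DFunLike.congr_fun h3 (b κ)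
  have h5 := mfderiv_toEnd b hι (cj 1) ((mfderiv (𝓡 r) (𝓡 r) cj 1 : E r →L[ℝ] E r) (b κ))
  have h6 : cj 1 = 1 := by simp [cj]
  have h7 := h4.symm.trans h5
  refine Eq.trans ?_ (h7.trans ?_)
  · rfl
  · rw [h6, toEnd_one]
    rfl

end MaurerCartan


/-! ### Linear algebra of the absorption and the group `G⁽²⁾` -/

section Algebra

set_option linter.unusedSectionVars false

variable {n r : ℕ} {G : Type*} [TopologicalSpace G] [ChartedSpace (E r) G] [Group G]
  [LieGroup (𝓡 r) ω G] {ι : G →* (E n ≃L[ℝ] E n)} {A : E n → E n ≃L[ℝ] E n}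
  {b : Module.Basis (Fin r) ℝ (GroupLieAlgebra (𝓡 r) G)}

/-- `linTorsion` as a linear map in `z`. -/
def linTorsionLin (ι : G →* (E n ≃L[ℝ] E n))
    (b : Module.Basis (Fin r) ℝ (GroupLieAlgebra (𝓡 r) G)) :
    (Fin r × Fin n → ℝ) →ₗ[ℝ] (TIdx n → ℝ) where
  toFun := linTorsion ι b
  map_add' z z' := by
    funext t
    simp only [linTorsion, Pi.add_apply, ← Finset.sum_add_distrib]
    exact Finset.sum_congr rfl fun κ _ => by ring
  map_smul' c z := by
    funext t
    simp only [linTorsion, Pi.smul_apply, smul_eq_mul, Finset.mul_sum, RingHom.id_apply]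
    exact Finset.sum_congr rfl fun κ _ => by ring

theorem linTorsionLin_apply (z : Fin r × Fin n → ℝ) :
    linTorsionLin ι b z = linTorsion ι b z := rfl

/-- This puts both sides of (1) in the same form, so that a single equivariance argument covers
them. -/
theorem B_eq_C_one (ι : G →* (E n ≃L[ℝ] E n)) (A : E n → E n ≃L[ℝ] E n) (X : E n) :
    B A X = C ι A X 1 := by
  funext t
  simp only [B, C, map_one]
  rfl

namespace Absorption

variable (D : Absorption ι A b)

theorem P_mulVec_apply_par (v : Fin r × Fin n → ℝ) {a : Fin r × Fin n} (ha : a ∈ D.par) :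
    (D.P *ᵥ v) a = v a := by
  simp [Matrix.mulVec, D.P_parametric a ha]

theorem Q_mulVec_apply_par (c : TIdx n → ℝ) {a : Fin r × Fin n} (ha : a ∈ D.par) :
    (D.Q *ᵥ c) a = 0 := by
  simp [Matrix.mulVec, D.Q_parametric a ha]

/-- Parametric rows of `P` are unit rows and principal rows vanish in the principal columns, so `P`
sees only the parametric variables. Consequently `P` is a projection and kills the image of `Q`. -/
theorem P_mulVec_congr {v v' : Fin r × Fin n → ℝ} (h : ∀ a ∈ D.par, v a = v' a) :
    D.P *ᵥ v = D.P *ᵥ v' := by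
  funext a
  by_cases ha : a ∈ D.par
  · rw [D.P_mulVec_apply_par v ha, D.P_mulVec_apply_par v' ha, h a ha]
  · refine Finset.sum_congr rfl fun a' _ => ?_
    by_cases ha' : a' ∈ D.par
    · rw [h a' ha']
    · simp [D.P_principal a ha a' ha']

theorem P_P (v : Fin r × Fin n → ℝ) : D.P *ᵥ (D.P *ᵥ v) = D.P *ᵥ v :=
  D.P_mulVec_congr fun _ ha => D.P_mulVec_apply_par v ha

theorem P_Q (c : TIdx n → ℝ) : D.P *ᵥ (D.Q *ᵥ c) = 0 := by
  rw [D.P_mulVec_congr (v' := 0) fun _ ha => D.Q_mulVec_apply_par c ha, Matrix.mulVec_zero]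

/-- `Qc` is the solution of the normalized equations whose parametric variables are all zero. -/
theorem linTorsion_Q (x : E n) (g : G) :
    linTorsion ι b (D.Q *ᵥ (C ι A x g - D.const)) = -(C ι A x g - D.const) := by
  funext t
  have h := (D.solved x g (D.Q *ᵥ (C ι A x g - D.const))).2 (by rw [D.P_Q, zero_add]) t
  simp only [Pi.neg_apply, Pi.sub_apply]
  linarith

/-- Two solutions of the normalized equations differ by an element of the kernel. Comparing `Qc + z`
with `Qc` over one point identifies the kernel with the fixed vectors of `P`, which are its image.
-/
theorem linTorsion_eq_zero_iff (z : Fin r × Fin n → ℝ) :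
    linTorsion ι b z = 0 ↔ D.P *ᵥ z = z := by
  set c := C ι A 0 1 - D.const with hc
  -- Any base point would serve: the linear part does not depend on it.
  have h := D.solved 0 1 (D.Q *ᵥ c + z)
  have h1 : linTorsion ι b (D.Q *ᵥ c + z) = -c + linTorsion ι b z := by
    rw [← linTorsionLin_apply, map_add, linTorsionLin_apply, linTorsionLin_apply, D.linTorsion_Q]
  rw [h1, Matrix.mulVec_add, D.P_Q, zero_add, ← hc, add_comm (D.P *ᵥ z), add_right_inj] at h
  rw [eq_comm (b := z), ← h]
  refine ⟨fun hz t => ?_, fun hz => ?_⟩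
  · simp [hz, hc]
  · funext t
    have := hz t
    simp only [Pi.add_apply, Pi.neg_apply, hc, Pi.sub_apply] at this
    simp only [Pi.zero_apply]
    linarith

/-- The difference of the two particular solutions absorbs the difference of the torsions, and what
is left of `y` must lie in the kernel, the image of `P`. The left side is how `y` arises from (2),
the right side is how it arises from (1). -/
theorem exists_P_eq_iff (x x' : E n) (g g' : G) (y : Fin r × Fin n → ℝ) :
    (∃ v, y = D.Q *ᵥ (C ι A x g - D.const) - D.Q *ᵥ (C ι A x' g' - D.const) - D.P *ᵥ v) ↔
      ∀ t, C ι A x' g' t = linTorsion ι b y t + C ι A x g t := by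
  set q := D.Q *ᵥ (C ι A x g - D.const) - D.Q *ᵥ (C ι A x' g' - D.const) with hq
  have hlin : linTorsion ι b q = C ι A x' g' - C ι A x g := by
    rw [hq, ← linTorsionLin_apply, map_sub, linTorsionLin_apply, linTorsionLin_apply,
      D.linTorsion_Q, D.linTorsion_Q]
    abel
  have key : (∀ t, C ι A x' g' t = linTorsion ι b y t + C ι A x g t) ↔
      linTorsion ι b (q - y) = 0 := by
    rw [← linTorsionLin_apply (z := q - y), map_sub, linTorsionLin_apply, linTorsionLin_apply, hlin,
      funext_iff]
    refine forall_congr' fun t => ?_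
    simp only [Pi.sub_apply, Pi.zero_apply]
    constructor <;> intro h <;> linarith
  rw [key, D.linTorsion_eq_zero_iff]
  constructor
  · rintro ⟨v, rfl⟩
    rw [sub_sub_cancel, D.P_P]
  · intro h
    exact ⟨q - y, by rw [h]; abel⟩

/-- The kernel of `linTorsion` is parametrized by the parametric variables. -/
def kerEquiv : LinearMap.ker (linTorsionLin ι b) ≃ₗ[ℝ] (D.par → ℝ) where
  toFun z a := z.1 a
  map_add' _ _ := rfl
  map_smul' _ _ := rfl
  invFun v := ⟨D.P *ᵥ fun a => if h : a ∈ D.par then v ⟨a, h⟩ else 0, by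
    rw [LinearMap.mem_ker, linTorsionLin_apply, D.linTorsion_eq_zero_iff, D.P_P]⟩
  left_inv z := by
    ext1
    have h := (D.linTorsion_eq_zero_iff z.1).1 z.2
    refine Eq.trans (D.P_mulVec_congr fun a ha => ?_) h
    simp [ha]
  right_inv v := by
    funext a
    simp [D.P_mulVec_apply_par _ a.2]

theorem exists_affineSubspace (x X : E n) (g : G) :
    ∃ S : AffineSubspace ℝ (Fin r × Fin n → ℝ),
      (∀ z, z ∈ S ↔ SecondOrderEq ι A b x X g z) ∧ (S : Set (Fin r × Fin n → ℝ)).Nonempty ∧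
        Module.finrank ℝ S.direction = D.par.card := by
  obtain ⟨z₀, hz₀⟩ : ∃ z, SecondOrderEq ι A b x X g z := by
    -- Absorb over `(x, g)` and over `(X, 1)` and subtract; solvability of the normalized equations
    -- over both points gives a solution of (1).
    refine ⟨D.Q *ᵥ (C ι A x g - D.const) - D.Q *ᵥ (C ι A X 1 - D.const) - D.P *ᵥ 0, ?_⟩
    rw [SecondOrderEq, B_eq_C_one ι A X]
    exact (D.exists_P_eq_iff x X g 1 _).1 ⟨0, rfl⟩
  refine ⟨AffineSubspace.mk' z₀ (LinearMap.ker (linTorsionLin ι b)), fun z => ?_,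
    AffineSubspace.mk'_nonempty _ _, ?_⟩
  · rw [AffineSubspace.mem_mk', LinearMap.mem_ker, vsub_eq_sub, map_sub, linTorsionLin_apply,
      linTorsionLin_apply, funext_iff, SecondOrderEq]
    refine forall_congr' fun t => ?_
    have := hz₀ t
    simp only [Pi.sub_apply, Pi.zero_apply]
    constructor <;> intro h <;> linarith
  · rw [AffineSubspace.direction_mk', D.kerEquiv.finrank_eq]
    simp

/-- The system is triangular: `gη` determines `dx`, and then `π` determines `α`, hence `dg`. -/
theorem coframe_bijective (p : G1 n G) :
    Function.Bijective fun w : T1 n r => (D.coframe p w, w.2.1) := by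
  constructor
  · rintro ⟨w₁, w₂, w₃⟩ ⟨w₁', w₂', w₃'⟩ h
    simp only [Prod.mk.injEq] at h
    obtain ⟨h, rfl⟩ := h
    have h1 : gEta ι A p (w₁, w₂, w₃) = gEta ι A p (w₁', w₂, w₃') := by
      ext j
      exact congrFun h (Sum.inl j)
    have h2 : w₁ = w₁' := (A p.1).injective ((ι p.2.2).injective h1)
    subst h2
    have h3 : w₃ = w₃' := by
      refine alphaLin_injective b p.2.2 (funext fun κ => ?_)
      have := congrFun h (Sum.inr κ)
      simp only [coframe, Sum.elim_inr, piForm] at this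
      exact sub_left_injective this
    rw [h3]
  · rintro ⟨f, X⟩
    set u : E n := WithLp.toLp 2 fun j => f (Sum.inl j) with hu
    obtain ⟨w₃, hw₃⟩ := (alphaLin_bijective b p.2.2).2 fun κ => f (Sum.inr κ) +
      ∑ j, (D.Q *ᵥ (C ι A p.1 p.2.2 - D.const)) (κ, j) * u j
    have h1 : gEta ι A p ((A p.1).symm ((ι p.2.2).symm u), X, w₃) = u := by
      simp [gEta]
    refine ⟨((A p.1).symm ((ι p.2.2).symm u), X, w₃), ?_⟩
    simp only [Prod.mk.injEq, and_true]
    funext s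
    rcases s with j | κ
    · simp only [coframe, Sum.elim_inl]
      rw [h1]
    · have h2 := congrFun hw₃ κ
      rw [alphaLin_apply] at h2
      simp only [coframe, Sum.elim_inr, piForm, h1, h2, add_sub_cancel_right]

theorem G2_commute : ∀ m ∈ D.G2, ∀ m' ∈ D.G2, m * m' = m' * m := by
  rintro m ⟨v, hv⟩ m' ⟨y, hy⟩
  ext1
  rw [Units.val_mul, Units.val_mul, hv, hy, block_mul, block_mul, add_comm]

/-- The element of `GL` with matrix `block v`. -/
def blockUnit (v : Fin r × Fin n → ℝ) : GL (Fin n ⊕ Fin r) ℝ where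
  val := D.block v
  inv := D.block (-v)
  val_inv := by rw [block_mul, add_neg_cancel, block_zero]
  inv_val := by rw [block_mul, neg_add_cancel, block_zero]

theorem blockUnit_mem (v : Fin r × Fin n → ℝ) : D.blockUnit v ∈ D.G2 := ⟨v, rfl⟩

/-- Extension of a vector of parametric variables by zero. -/
def extendPar : (D.par → ℝ) →ₗ[ℝ] (Fin r × Fin n → ℝ) where
  toFun v a := if h : a ∈ D.par then v ⟨a, h⟩ else 0
  map_add' v v' := by
    funext a
    by_cases h : a ∈ D.par <;> simp [h]
  map_smul' c v := by
    funext a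
    by_cases h : a ∈ D.par <;> simp [h]

theorem block_apply (v : Fin r × Fin n → ℝ) (a : Fin r × Fin n) :
    D.block v (Sum.inr a.1) (Sum.inl a.2) = (D.P *ᵥ v) a := rfl

theorem block_congr {v v' : Fin r × Fin n → ℝ} (h : ∀ a ∈ D.par, v a = v' a) :
    D.block v = D.block v' := by
  simp only [block, M, D.P_mulVec_congr h]

theorem continuous_block : Continuous D.block := by
  unfold block M
  fun_prop

theorem exists_parametrization :
    ∃ θ : Multiplicative (D.par → ℝ) ≃ₜ* D.G2, ∀ (v : D.par → ℝ) (a : D.par),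
      ((θ (Multiplicative.ofAdd v) : GL (Fin n ⊕ Fin r) ℝ) :
        Matrix (Fin n ⊕ Fin r) (Fin n ⊕ Fin r) ℝ) (Sum.inr a.1.1) (Sum.inl a.1.2) = v a := by
  have hθ : ∀ (v : D.par → ℝ) (a : D.par),
      D.block (D.extendPar v) (Sum.inr a.1.1) (Sum.inl a.1.2) = v a := by
    intro v a
    rw [block_apply, D.P_mulVec_apply_par _ a.2]
    simp [extendPar]
  have hc : Continuous fun v : Multiplicative (D.par → ℝ) =>
      D.extendPar (Multiplicative.toAdd v) :=
    D.extendPar.continuous_of_finiteDimensional.comp continuous_toAdd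
  refine ⟨{
    toFun := fun v => ⟨D.blockUnit (D.extendPar (Multiplicative.toAdd v)), D.blockUnit_mem _⟩
    invFun := fun m => Multiplicative.ofAdd fun a =>
      ((m : GL (Fin n ⊕ Fin r) ℝ) :
        Matrix (Fin n ⊕ Fin r) (Fin n ⊕ Fin r) ℝ) (Sum.inr a.1.1) (Sum.inl a.1.2)
    left_inv := fun v => by
      refine Multiplicative.toAdd.injective (funext fun a => ?_)
      exact hθ _ a
    right_inv := by
      rintro ⟨m, v, hv⟩
      ext1
      -- The parametric entries of `M(v)` are those of `v`, and they already determine the whole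
      -- block.
      refine Units.ext (Eq.trans (D.block_congr fun a ha => ?_) hv.symm)
      simp only [toAdd_ofAdd, extendPar, LinearMap.coe_mk, AddHom.coe_mk, ha, dite_true]
      rw [hv, D.block_apply v a, D.P_mulVec_apply_par _ ha]
    map_mul' := fun v y => by
      ext1
      refine Units.ext ?_
      change D.block _ = D.block _ * D.block _
      rw [block_mul, toAdd_mul, map_add]
    continuous_toFun := by
      refine Continuous.subtype_mk (Units.continuous_iff.2 ⟨?_, ?_⟩) _
      · exact D.continuous_block.comp hc
      · exact D.continuous_block.comp hc.neg
    continuous_invFun := by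
      refine continuous_ofAdd.comp (continuous_pi fun a => ?_)
      exact (Units.continuous_val.comp continuous_subtype_val).matrix_elem _ _ }, hθ⟩

end Absorption

end Algebra


/-! ### Equivariance of the torsion and the correspondence of jets -/

section Jets

set_option linter.unusedSectionVars false

variable {n r : ℕ} {G : Type*} [TopologicalSpace G] [ChartedSpace (E r) G] [Group G]
  [LieGroup (𝓡 r) ω G] {ι : G →* (E n ≃L[ℝ] E n)} {A : E n → E n ≃L[ℝ] E n}
  {b : Module.Basis (Fin r) ℝ (GroupLieAlgebra (𝓡 r) G)}

theorem end_add_smul (c d : ℝ) (T : E n →L[ℝ] E n) : (c + d) • T = c • T + d • T :=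
  add_smul c d T

theorem end_sub_smul (c d : ℝ) (T : E n →L[ℝ] E n) : (c - d) • T = c • T - d • T :=
  sub_smul c d T

theorem end_sum_smul {κ : Type*} (s : Finset κ) (c : κ → ℝ) (T : E n →L[ℝ] E n) :
    (∑ k ∈ s, c k) • T = ∑ k ∈ s, c k • T :=
  Finset.sum_smul (f := c) (s := s) (x := T)

/-- The Lie-algebra-valued 1-form `∑ F_κ z^κ_j u^j` on `ℝⁿ` with components `z`. -/
def conn (ι : G →* (E n ≃L[ℝ] E n)) (b : Module.Basis (Fin r) ℝ (GroupLieAlgebra (𝓡 r) G))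
    (z : Fin r × Fin n → ℝ) : E n →ₗ[ℝ] (E n →L[ℝ] E n) where
  toFun u := ∑ κ, (∑ j, z (κ, j) * u j) • F ι b κ
  map_add' u u' := by
    simp only [PiLp.add_apply, mul_add, Finset.sum_add_distrib, end_add_smul]
  map_smul' c u := by
    simp only [PiLp.smul_apply, smul_eq_mul, RingHom.id_apply, Finset.smul_sum, smul_smul,
      Finset.mul_sum, mul_left_comm]

theorem conn_apply (z : Fin r × Fin n → ℝ) (u : E n) :
    conn ι b z u = ∑ κ, (∑ j, z (κ, j) * u j) • F ι b κ := rfl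

theorem sum_mul_single (f : Fin n → ℝ) (j : Fin n) : ∑ i, f i * (e j : E n) i = f j := by
  simp [e]

theorem conn_basis (z : Fin r × Fin n → ℝ) (j : Fin n) :
    conn ι b z (e j) = ∑ κ, z (κ, j) • F ι b κ := by
  simp only [conn_apply, sum_mul_single fun i => z (_, i)]

theorem conn_injective (hι : IsLieSubgroup (r := r) ι) {z z' : Fin r × Fin n → ℝ}
    (h : ∀ u, conn ι b z u = conn ι b z' u) : z = z' := by
  funext ⟨κ, j⟩
  have h1 := h (e j)
  rw [conn_basis, conn_basis] at h1
  exact congrFun (sum_smul_F_injective b hι h1) κ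

theorem linearMap_ext_basis {V : Type*} [AddCommGroup V] [Module ℝ V] {f f' : E n →ₗ[ℝ] V}
    (h : ∀ j, f (e j) = f' (e j)) : f = f' :=
  (EuclideanSpace.basisFun (Fin n) ℝ).toBasis.ext fun j => by simpa using h j

/-- `Ad(g)` acts on Lie-algebra-valued 1-forms. -/
theorem exists_conn_conj (hι : IsLieSubgroup (r := r) ι) (g : G) (z : Fin r × Fin n → ℝ) :
    ∃ y, ∀ u, conn ι b y (ι g u) = toEnd ι g ∘L conn ι b z u ∘L toEnd ι g⁻¹ := by
  obtain ⟨a, ha⟩ := exists_conj_F b hι g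
  -- The components of `u ↦ Ad(g)(z(g⁻¹u))` in the basis `F_κ`, with `a` the matrix of `Ad(g)`.
  let y : Fin r × Fin n → ℝ := fun s => ∑ κ, (∑ i, z (κ, i) * (ι g⁻¹ (e s.2)) i) * a κ s.1
  let Ad : (E n →L[ℝ] E n) →ₗ[ℝ] (E n →L[ℝ] E n) :=
    ((ContinuousLinearMap.compL ℝ (E n) (E n) (E n) (toEnd ι g)) ∘L
      ((ContinuousLinearMap.compL ℝ (E n) (E n) (E n)).flip (toEnd ι g⁻¹))).toLinearMap
  have hAd : ∀ T, Ad T = toEnd ι g ∘L T ∘L toEnd ι g⁻¹ := fun T => rfl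
  have key : conn ι b y = Ad ∘ₗ conn ι b z ∘ₗ (toEnd ι g⁻¹ : E n →L[ℝ] E n).toLinearMap := by
    refine linearMap_ext_basis fun j => ?_
    have h1 : ∀ κ, Ad (F ι b κ) = ∑ κ', a κ κ' • F ι b κ' := fun κ => (hAd _).trans (ha κ)
    let s : Fin r → ℝ := fun κ => ∑ i, z (κ, i) * (ι g⁻¹ (e j)) i
    have hR : (Ad ∘ₗ conn ι b z ∘ₗ (toEnd ι g⁻¹ : E n →L[ℝ] E n).toLinearMap) (e j) =
        Ad (∑ κ, s κ • F ι b κ) := rfl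
    rw [conn_basis, hR, map_sum]
    change ∑ κ', (∑ κ, s κ * a κ κ') • F ι b κ' = _
    simp only [map_smul, h1, Finset.smul_sum, smul_smul, end_sum_smul]
    exact Finset.sum_comm
  refine ⟨y, fun u => ?_⟩
  rw [key, ← hAd]
  simp only [LinearMap.comp_apply, ContinuousLinearMap.coe_coe, toEnd_apply, inv_apply_apply]

/-- `∑ (F_κ u') z^κ(u) - (F_κ u) z^κ(u')`, the 2-form with components `linTorsion`. -/
def torsionForm (ι : G →* (E n ≃L[ℝ] E n)) (b : Module.Basis (Fin r) ℝ (GroupLieAlgebra (𝓡 r) G))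
    (z : Fin r × Fin n → ℝ) : E n →ₗ[ℝ] E n →ₗ[ℝ] E n :=
  LinearMap.mk₂ ℝ (fun u u' => conn ι b z u u' - conn ι b z u' u)
    (fun _ _ _ => by simp only [map_add, _root_.add_apply]; abel)
    (fun _ _ _ => by simp only [map_smul, _root_.smul_apply, smul_sub])
    (fun _ _ _ => by simp only [map_add, _root_.add_apply]; abel)
    (fun _ _ _ => by simp only [map_smul, _root_.smul_apply, smul_sub])

theorem torsionForm_apply (z : Fin r × Fin n → ℝ) (u u' : E n) :
    torsionForm ι b z u u' = conn ι b z u u' - conn ι b z u' u := rfl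

theorem linTorsion_eq (z : Fin r × Fin n → ℝ) (t : TIdx n) :
    linTorsion ι b z t = torsionForm ι b z (e t.2.1.1) (e t.2.1.2) t.1 := by
  rw [torsionForm_apply, conn_basis, conn_basis]
  simp only [linTorsion, PiLp.sub_apply, _root_.sum_apply, WithLp.ofLp_sum,
    Finset.sum_apply, _root_.smul_apply, PiLp.smul_apply, smul_eq_mul,
    ← Finset.sum_sub_distrib, mul_comm]

theorem update_left (u v w : E n) : Function.update ![u, w] 0 v = ![v, w] := by
  ext1 i; fin_cases i <;> rfl

theorem update_right (u v w : E n) : Function.update ![u, w] 1 v = ![u, v] := by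
  ext1 i; fin_cases i <;> rfl

theorem vecCons_add_left (f : E n [⋀^Fin 2]→L[ℝ] E n) (u v w : E n) :
    f ![u + v, w] = f ![u, w] + f ![v, w] := by
  simpa only [update_left] using f.map_update_add ![0, w] 0 u v

theorem vecCons_smul_left (f : E n [⋀^Fin 2]→L[ℝ] E n) (c : ℝ) (u w : E n) :
    f ![c • u, w] = c • f ![u, w] := by
  simpa only [update_left] using f.map_update_smul ![0, w] 0 c u

theorem vecCons_add_right (f : E n [⋀^Fin 2]→L[ℝ] E n) (u v w : E n) :
    f ![w, u + v] = f ![w, u] + f ![w, v] := by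
  simpa only [update_right] using f.map_update_add ![w, 0] 1 u v

theorem vecCons_smul_right (f : E n [⋀^Fin 2]→L[ℝ] E n) (c : ℝ) (u w : E n) :
    f ![w, c • u] = c • f ![w, u] := by
  simpa only [update_right] using f.map_update_smul ![w, 0] 1 c u

/-- The 2-form `g dη` in the frame dual to `gη`. -/
def structureForm (ι : G →* (E n ≃L[ℝ] E n)) (A : E n → E n ≃L[ℝ] E n) (x : E n) (g : G) :
    E n →ₗ[ℝ] E n →ₗ[ℝ] E n :=
  LinearMap.mk₂ ℝ (fun u u' => ι g (extDeriv (eta A) x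
      ![(A x).symm ((ι g).symm u), (A x).symm ((ι g).symm u')]))
    (fun u v w => by
      simp only [map_add]
      exact (congrArg (ι g) (vecCons_add_left (extDeriv (eta A) x) _ _ _)).trans (map_add _ _ _))
    (fun c u w => by
      simp only [map_smul]
      exact (congrArg (ι g) (vecCons_smul_left (extDeriv (eta A) x) _ _ _)).trans (map_smul _ _ _))
    (fun w u v => by
      simp only [map_add]
      exact (congrArg (ι g) (vecCons_add_right (extDeriv (eta A) x) _ _ _)).trans (map_add _ _ _))
    (fun c w u => by
      simp only [map_smul]
      exact (congrArg (ι g) (vecCons_smul_right (extDeriv (eta A) x) _ _ _)).trans (map_smul _ _ _))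

theorem structureForm_apply (x : E n) (g : G) (u u' : E n) :
    structureForm ι A x g u u' = ι g (extDeriv (eta A) x
      ![(A x).symm ((ι g).symm u), (A x).symm ((ι g).symm u')]) := rfl

theorem structureForm_self (x : E n) (g : G) (u : E n) : structureForm ι A x g u u = 0 := by
  rw [structureForm_apply, (extDeriv (eta A) x).map_eq_zero_of_eq _ (i := 0) (j := 1) (by simp)
    (by simp), map_zero]

theorem C_eq (x : E n) (g : G) (t : TIdx n) :
    C ι A x g t = structureForm ι A x g (e t.2.1.1) (e t.2.1.2) t.1 := rfl

/-- Passing from `hη` to `khη` moves the dual frame by `k⁻¹` and the values by `k`. -/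
theorem structureForm_mul (x : E n) (k h : G) (u u' : E n) :
    structureForm ι A x (k * h) (ι k u) (ι k u') = ι k (structureForm ι A x h u u') := by
  have h1 : ∀ u, (ι (k * h)).symm (ι k u) = (ι h).symm u := fun u => by
    rw [ContinuousLinearEquiv.symm_apply_eq, ← toEnd_apply ι (k * h), toEnd_mul]
    simp [toEnd_apply]
  rw [structureForm_apply, h1, h1, ← toEnd_apply ι (k * h), toEnd_mul]
  rfl

/-- An alternating bilinear map is determined by its components with `j < k`. -/
theorem forall_TIdx_iff (T : E n →ₗ[ℝ] E n →ₗ[ℝ] E n) (hT : ∀ u, T u u = 0) :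
    (∀ t : TIdx n, T (e t.2.1.1) (e t.2.1.2) t.1 = 0) ↔ ∀ u u', T u u' = 0 := by
  refine ⟨fun h => ?_, fun h t => by rw [h]; rfl⟩
  have hlt : ∀ j k : Fin n, j < k → T (e j) (e k) = 0 := fun j k hjk => by
    ext i
    exact h (i, ⟨(j, k), hjk⟩)
  have hneg : ∀ u u', T u u' = -T u' u := fun u u' => by
    have := hT (u + u')
    simp only [map_add, LinearMap.add_apply, hT, zero_add, add_zero] at this
    exact eq_neg_of_add_eq_zero_right this
  have h0 : T = 0 := by
    refine linearMap_ext_basis fun j => linearMap_ext_basis fun k => ?_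
    rcases lt_trichotomy j k with hjk | rfl | hjk
    · exact hlt j k hjk
    · exact hT _
    · rw [hneg, hlt k j hjk]
      simp
  intro u u'
  rw [h0]
  rfl

theorem forall_C_eq_iff (x x' : E n) (g g' : G) (y : Fin r × Fin n → ℝ) :
    (∀ t, C ι A x' g' t = linTorsion ι b y t + C ι A x g t) ↔
      ∀ u u', structureForm ι A x' g' u u' =
        torsionForm ι b y u u' + structureForm ι A x g u u' := by
  have h := forall_TIdx_iff
    (structureForm ι A x' g' - (torsionForm ι b y + structureForm ι A x g)) fun u => by
      simp only [LinearMap.sub_apply, LinearMap.add_apply, structureForm_self, torsionForm_apply,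
        sub_self, add_zero]
  simp only [LinearMap.sub_apply, LinearMap.add_apply, sub_eq_zero, PiLp.sub_apply,
    PiLp.add_apply] at h
  simp only [C_eq, linTorsion_eq]
  exact h

/-- Equivariance of the second order equations. -/
theorem forall_C_eq_iff_secondOrderEq (x x' : E n) (k h : G) {y z : Fin r × Fin n → ℝ}
    (hy : ∀ u, conn ι b y (ι k u) = toEnd ι k ∘L conn ι b z u ∘L toEnd ι k⁻¹) :
    (∀ t, C ι A x' k t = linTorsion ι b y t + C ι A x (k * h) t) ↔
      SecondOrderEq ι A b x x' h z := by
  rw [SecondOrderEq, B_eq_C_one ι A x', forall_C_eq_iff, forall_C_eq_iff,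
    (ι k).surjective.forall₂]
  refine forall₂_congr fun u u' => ?_
  have h1 : torsionForm ι b y (ι k u) (ι k u') = ι k (torsionForm ι b z u u') := by
    rw [torsionForm_apply, torsionForm_apply, hy, hy, map_sub]
    -- In `k z(u) k⁻¹` applied to `k u'` the inner factors cancel, so the torsion of `y` is the
    -- torsion of `z` transported by `k`.
    simp only [ContinuousLinearMap.comp_apply, toEnd_apply, inv_apply_apply]
  have h2 := structureForm_mul (ι := ι) (A := A) x' k 1 u u'
  rw [mul_one] at h2
  rw [h1, h2, structureForm_mul, ← map_add, (ι k).injective.eq_iff]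

namespace Absorption

variable (D : Absorption ι A b)

/-- The upper block identifies `gη` at both ends, so in the lower block every correction to `α` is a
multiple of the same vector. Collecting these corrections and contracting with the independent `F_κ`
gives the Maurer-Cartan form of (2). -/
theorem coframe_eq_block_iff (hι : IsLieSubgroup (r := r) ι) (p q : G1 n G) (w w' : T1 n r)
    (v : Fin r × Fin n → ℝ) :
    D.coframe q w' = D.block v *ᵥ D.coframe p w ↔
      gEta ι A q w' = gEta ι A p w ∧
      ∑ κ, alpha b κ q.2.2 w'.2.2 • F ι b κ = ∑ κ, alpha b κ p.2.2 w.2.2 • F ι b κ -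
        conn ι b (D.Q *ᵥ (C ι A p.1 p.2.2 - D.const) - D.Q *ᵥ (C ι A q.1 q.2.2 - D.const) -
          D.P *ᵥ v) (gEta ι A p w) := by
  have h1 : D.block v *ᵥ D.coframe p w = Sum.elim (fun j => gEta ι A p w j)
      (fun κ => ∑ j, (D.P *ᵥ v) (κ, j) * gEta ι A p w j + D.piForm p w κ) := by
    rw [block, coframe, Matrix.fromBlocks_mulVec]
    simp only [Matrix.one_mulVec, Matrix.zero_mulVec, add_zero, Sum.elim_comp_inl,
      Sum.elim_comp_inr]
    rfl
  have h2 : D.coframe q w' = D.block v *ᵥ D.coframe p w ↔ gEta ι A q w' = gEta ι A p w ∧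
      ∀ κ, D.piForm q w' κ =
        ∑ j, (D.P *ᵥ v) (κ, j) * gEta ι A p w j + D.piForm p w κ := by
    rw [h1, coframe, Sum.elim_eq_iff, funext_iff, funext_iff, PiLp.ext_iff]
  rw [h2]
  refine and_congr_right fun h => ?_
  have h3 : ∑ κ, alpha b κ p.2.2 w.2.2 • F ι b κ -
        conn ι b (D.Q *ᵥ (C ι A p.1 p.2.2 - D.const) - D.Q *ᵥ (C ι A q.1 q.2.2 - D.const) -
          D.P *ᵥ v) (gEta ι A p w) = ∑ κ, (alpha b κ p.2.2 w.2.2 -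
          ∑ j, (D.Q *ᵥ (C ι A p.1 p.2.2 - D.const) - D.Q *ᵥ (C ι A q.1 q.2.2 - D.const) -
          D.P *ᵥ v) (κ, j) * gEta ι A p w j) • F ι b κ := by
    simp only [end_sub_smul, Finset.sum_sub_distrib, conn_apply]
  rw [h3]
  have h4 : ∀ κ, D.piForm q w' κ = ∑ j, (D.P *ᵥ v) (κ, j) * gEta ι A p w j + D.piForm p w κ ↔
      alpha b κ q.2.2 w'.2.2 = alpha b κ p.2.2 w.2.2 -
          ∑ j, (D.Q *ᵥ (C ι A p.1 p.2.2 - D.const) - D.Q *ᵥ (C ι A q.1 q.2.2 - D.const) -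
          D.P *ᵥ v) (κ, j) * gEta ι A p w j := by
    intro κ
    simp only [piForm, h, Pi.sub_apply, sub_mul, Finset.sum_sub_distrib]
    constructor <;> intro h5 <;> linarith
  simp only [h4]
  exact ⟨fun h5 => by simp only [h5], fun h5 => congrFun (sum_smul_F_injective b hι h5)⟩

theorem isActionJet_iff (X' : E n) (h : G) (z : Fin r × Fin n → ℝ)
    (p q : G1 n G) (L : T1 n r →L[ℝ] T1 n r) :
    IsActionJet ι A b X' h z p q L ↔ q = (X', p.2.1, p.2.2 * h⁻¹) ∧
      ∀ w, A X' (L w).1 = ι h (A p.1 w.1) ∧ (L w).2.1 = w.2.1 ∧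
        ∑ κ, alpha b κ q.2.2 (L w).2.2 • F ι b κ = ∑ κ, alpha b κ p.2.2 w.2.2 • F ι b κ -
          toEnd ι (p.2.2 * h⁻¹) ∘L conn ι b z (ι h (A p.1 w.1)) ∘L toEnd ι (p.2.2 * h⁻¹)⁻¹ :=
  Iff.rfl

theorem prolongedAt_of_isActionJet (hι : IsLieSubgroup (r := r) ι) {p q : G1 n G}
    {L : T1 n r →L[ℝ] T1 n r} {h : G} {z : Fin r × Fin n → ℝ}
    (hz : SecondOrderEq ι A b p.1 q.1 h z) (hL : IsActionJet ι A b q.1 h z p q L) :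
    D.ProlongedAt p q L := by
  obtain ⟨hq, hw⟩ := (isActionJet_iff ..).1 hL
  have hq2 : q.2.1 = p.2.1 := by rw [hq]
  have hq3 : q.2.2 = p.2.2 * h⁻¹ := by rw [hq]
  rw [← hq3] at hw
  have hp : q.2.2 * h = p.2.2 := by rw [hq3, inv_mul_cancel_right]
  obtain ⟨y, hy⟩ := exists_conn_conj (b := b) hι q.2.2 z
  have h1 := (forall_C_eq_iff_secondOrderEq (A := A) p.1 q.1 q.2.2 h hy).2 hz
  rw [hp] at h1
  obtain ⟨v, hv⟩ := (D.exists_P_eq_iff p.1 q.1 p.2.2 q.2.2 y).2 h1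
  refine ⟨⟨hq2, fun w => (hw w).2.1⟩, D.blockUnit v, D.blockUnit_mem v, fun w => ?_⟩
  have hη : ι q.2.2 (ι h (A p.1 w.1)) = gEta ι A p w := by
    rw [gEta, ← hp, ← toEnd_apply ι (q.2.2 * h), toEnd_mul]
    rfl
  refine (D.coframe_eq_block_iff hι p q w (L w) v).2 ⟨?_, ?_⟩
  · rw [← hη, ← (hw w).1]
    rfl
  · rw [← hv, (hw w).2.2, ← hη, hy]

theorem prolongedAt_iff (hι : IsLieSubgroup (r := r) ι) (p q : G1 n G)
    (L : T1 n r →L[ℝ] T1 n r) : D.ProlongedAt p q L ↔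
      ∃! hz : G × (Fin r × Fin n → ℝ),
        SecondOrderEq ι A b p.1 q.1 hz.1 hz.2 ∧ IsActionJet ι A b q.1 hz.1 hz.2 p q L := by
  constructor
  swap
  · rintro ⟨⟨h, z⟩, ⟨hz, hL⟩, -⟩
    exact D.prolongedAt_of_isActionJet hι hz hL
  rintro ⟨⟨hX, hLX⟩, m, ⟨v, hm⟩, hw⟩
  rw [hm] at hw
  replace hw := fun w => (D.coframe_eq_block_iff hι p q w (L w) v).1 (hw w)
  set y := D.Q *ᵥ (C ι A p.1 p.2.2 - D.const) - D.Q *ᵥ (C ι A q.1 q.2.2 - D.const) - D.P *ᵥ v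
    with hy_def
  -- The second order coordinates of the jet: `y` carried back by the inverse of the group
  -- coordinate of `q`.
  obtain ⟨z, hz⟩ := exists_conn_conj (b := b) hι q.2.2⁻¹ y
  have hy : ∀ u, conn ι b y (ι q.2.2 u) =
      toEnd ι q.2.2 ∘L conn ι b z u ∘L toEnd ι q.2.2⁻¹ := fun u => by
    have h1 := hz (ι q.2.2 u)
    rw [inv_apply_apply] at h1
    rw [h1]
    ext1 u'
    simp only [ContinuousLinearMap.comp_apply, toEnd_apply, inv_inv, apply_inv_apply]
  have hh : p.2.2 * (q.2.2⁻¹ * p.2.2)⁻¹ = q.2.2 := by group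
  have hη : ∀ w, ι q.2.2 (ι (q.2.2⁻¹ * p.2.2) (A p.1 w.1)) = gEta (r := r) ι A p w := fun w => by
    rw [gEta, ← toEnd_apply ι (q.2.2⁻¹ * p.2.2), toEnd_mul, ContinuousLinearMap.comp_apply,
      toEnd_apply, toEnd_apply, apply_inv_apply]
  refine ⟨(q.2.2⁻¹ * p.2.2, z), ⟨?_, ?_⟩, ?_⟩
  · rw [← forall_C_eq_iff_secondOrderEq (A := A) p.1 q.1 q.2.2 _ hy, mul_inv_cancel_left]
    exact (D.exists_P_eq_iff p.1 q.1 p.2.2 q.2.2 y).1 ⟨v, rfl⟩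
  · rw [isActionJet_iff, hh]
    refine ⟨Prod.ext rfl (Prod.ext hX rfl), fun w => ⟨?_, hLX w, ?_⟩⟩
    · refine (ι q.2.2).injective ?_
      rw [hη]
      exact (hw w).1
    · rw [(hw w).2, ← hη, hy]
  · rintro ⟨h, z'⟩ ⟨-, hL⟩
    rw [isActionJet_iff] at hL
    obtain ⟨hq, hL⟩ := hL
    have hq3 : p.2.2 * h⁻¹ = q.2.2 := (congrArg (fun q : G1 n G => q.2.2) hq).symm
    have hh' : h = q.2.2⁻¹ * p.2.2 := by rw [← hq3]; group
    subst hh'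
    refine Prod.ext rfl (conn_injective (b := b) hι fun u => ?_)
    -- The vector on which `hη` takes the value `u`; testing on it recovers the Lie-algebra-valued
    -- form with components `z'`.
    let w : T1 n r := ((A p.1).symm (ι (q.2.2⁻¹ * p.2.2)⁻¹ u), 0, 0)
    have hwu : ι (q.2.2⁻¹ * p.2.2) (A p.1 w.1) = u := by
      simp only [w, ContinuousLinearEquiv.apply_symm_apply, apply_inv_apply]
    have h1 := (hL w).2.2
    rw [hh, hwu, (hw w).2, ← hη, hwu, hy, sub_right_inj] at h1
    ext1 u'
    have h2 := DFunLike.congr_fun h1 (ι q.2.2 u')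
    simp only [ContinuousLinearMap.comp_apply, toEnd_apply, inv_apply_apply] at h2
    exact ((ι q.2.2).injective h2).symm

end Absorption

end Jets


/-! ### Maps tangent to a right-invariant distribution -/

section Slice

theorem exists_bijective_add {X W : Type*} [NormedAddCommGroup X] [NormedSpace ℝ X]
    [NormedAddCommGroup W] [NormedSpace ℝ W] (T : X →L[ℝ] W) (hT : Function.Injective T) :
    ∃ V : Submodule ℝ W, Function.Bijective fun v : X × V => T v.1 + V.subtypeL v.2 := by
  obtain ⟨V, hV⟩ := Submodule.exists_isCompl (LinearMap.range T.toLinearMap)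
  refine ⟨V, ?_, fun w => ?_⟩
  · rintro ⟨v, s⟩ ⟨v', s'⟩ (hv : T v + (s : W) = T v' + (s' : W))
    have h0 : T (v - v') = ((s' - s : V) : W) := by
      rw [map_sub, Submodule.coe_sub, sub_eq_sub_iff_add_eq_add, hv, add_comm]
    have h3 : T (v - v') = 0 := Submodule.disjoint_def.1 hV.disjoint _ ⟨v - v', rfl⟩
      (h0 ▸ (s' - s).2)
    have h4 : v = v' := hT (by rwa [map_sub, sub_eq_zero] at h3)
    subst h4
    exact Prod.ext rfl (Subtype.ext (add_left_cancel hv))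
  · have hw : w ∈ LinearMap.range T.toLinearMap ⊔ V := by
      rw [hV.sup_eq_top]
      trivial
    obtain ⟨_, ⟨v, rfl⟩, s, hs, rfl⟩ := Submodule.mem_sup.1 hw
    exact ⟨(v, ⟨s, hs⟩), rfl⟩

/-- If an analytic map `H` to matrices is tangent to the right-invariant distribution to which the
immersed submanifold `f` is tangent, and passes through `f` at the identity matrix, then it factors
locally through `f`. Here `S` spans a complement of the tangent space of `f`. -/
theorem exists_factorization {X Y V Z : Type*} [NormedAddCommGroup X] [NormedSpace ℝ X]
    [FiniteDimensional ℝ X] [NormedAddCommGroup Y] [NormedSpace ℝ Y] [FiniteDimensional ℝ Y]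
    [NormedAddCommGroup V] [NormedSpace ℝ V] [FiniteDimensional ℝ V]
    [NormedAddCommGroup Z] [NormedSpace ℝ Z] {f : X → Y →L[ℝ] Y} {O : Set X} {y₀ : X}
    (hO : O ∈ 𝓝 y₀) (hf : ∀ y ∈ O, ContDiffAt ℝ ω f y)
    (hy₀ : f y₀ = ContinuousLinearMap.id ℝ Y) (S : V →L[ℝ] Y →L[ℝ] Y)
    (hbij : Function.Bijective fun v : X × V => fderiv ℝ f y₀ v.1 + S v.2)
    {H : Z → Y →L[ℝ] Y} {x₀ : Z}
    (hH : ContDiffAt ℝ ω H x₀) (h₀ : H x₀ = ContinuousLinearMap.id ℝ Y)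
    (hdH : ∀ᶠ x in 𝓝 x₀, ∀ u, ∃ T : Y →L[ℝ] Y, fderiv ℝ H x u = T ∘L H x ∧
      ∀ y ∈ O, ∃ v, fderiv ℝ f y v = T ∘L f y) :
    ∃ k : Z → X, ContDiffAt ℝ ω k x₀ ∧ k x₀ = y₀ ∧ ∀ᶠ x in 𝓝 x₀, H x = f (k x) := by
  have hy₀O : y₀ ∈ O := mem_of_mem_nhds hO
  -- Local coordinates on matrices in which each slice `s = const` is a right translate of `f`.
  -- Right translation preserves the distribution, so every slice inherits its tangency.
  let Ψ : X × V → (Y →L[ℝ] Y) := fun p => f p.1 ∘L (ContinuousLinearMap.id ℝ Y + S p.2)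
  have hΨd : ∀ p : X × V, p.1 ∈ O → ContDiffAt ℝ ω Ψ p := fun p hp =>
    ((hf _ hp).comp p contDiffAt_fst).clm_comp
      (contDiffAt_const.add (S.contDiff.comp contDiff_snd).contDiffAt)
  have hΨ' : ∀ p : X × V, p.1 ∈ O → ∀ v : X × V, fderiv ℝ Ψ p v =
      f p.1 ∘L S v.2 + fderiv ℝ f p.1 v.1 ∘L (ContinuousLinearMap.id ℝ Y + S p.2) := by
    intro p hp v
    have h1 : HasFDerivAt (fun p : X × V => f p.1)
        ((fderiv ℝ f p.1) ∘L ContinuousLinearMap.fst ℝ X V) p :=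
      HasFDerivAt.comp p ((hf _ hp).differentiableAt (by simp)).hasFDerivAt hasFDerivAt_fst
    have h2 : HasFDerivAt (fun p : X × V => ContinuousLinearMap.id ℝ Y + S p.2)
        (S ∘L ContinuousLinearMap.snd ℝ X V) p :=
      (HasFDerivAt.comp p S.hasFDerivAt hasFDerivAt_snd).const_add _
    rw [(h1.clm_comp h2).fderiv]
    rfl
  let p₀ : X × V := (y₀, 0)
  have hbij' : Function.Bijective (fderiv ℝ Ψ p₀) := by
    convert hbij using 1
    funext v
    rw [hΨ' p₀ hy₀O]
    simp only [p₀, hy₀, map_zero, add_zero, ContinuousLinearMap.comp_id,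
      ContinuousLinearMap.id_comp]
    exact add_comm _ _
  let Ψe : (X × V) ≃L[ℝ] (Y →L[ℝ] Y) :=
    (LinearEquiv.ofBijective (fderiv ℝ Ψ p₀).toLinearMap hbij').toContinuousLinearEquiv
  have hΨe : HasFDerivAt Ψ (Ψe : (X × V) →L[ℝ] (Y →L[ℝ] Y)) p₀ :=
    ((hΨd p₀ hy₀O).differentiableAt (by simp)).hasFDerivAt
  have hΨp₀ : Ψ p₀ = ContinuousLinearMap.id ℝ Y := by
    simp [Ψ, p₀, hy₀]
  let Θ := (hΨd p₀ hy₀O).localInverse hΨe (by simp)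
  have hΘ : ContDiffAt ℝ ω Θ (H x₀) := by
    rw [h₀, ← hΨp₀]
    exact (hΨd p₀ hy₀O).to_localInverse hΨe (by simp)
  have hs := (hΨd p₀ hy₀O).hasStrictFDerivAt' hΨe (by simp)
  have hleft : ∀ᶠ p in 𝓝 p₀, Θ (Ψ p) = p := hs.eventually_left_inverse
  have hright : ∀ᶠ T in 𝓝 (H x₀), Ψ (Θ T) = T := by
    rw [h₀, ← hΨp₀]
    exact hs.eventually_right_inverse
  have hΘ₀ : Θ (H x₀) = p₀ := by
    rw [h₀, ← hΨp₀]
    exact (hΨd p₀ hy₀O).localInverse_apply_image hΨe (by simp)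
  let K : Z → X × V := fun x => Θ (H x)
  have hK : ContDiffAt ℝ ω K x₀ := hΘ.comp x₀ hH
  have hK₀ : K x₀ = p₀ := hΘ₀
  have hKt : Filter.Tendsto K (𝓝 x₀) (𝓝 p₀) := by
    simpa only [hK₀] using hK.continuousAt.tendsto
  have hHt : Filter.Tendsto H (𝓝 x₀) (𝓝 (H x₀)) := hH.continuousAt
  have hO' : ∀ᶠ p : X × V in 𝓝 p₀, p.1 ∈ O :=
    continuous_fst.continuousAt.eventually hO
  have hev : ∀ᶠ x in 𝓝 x₀, DifferentiableAt ℝ K x ∧ Ψ (K x) = H x ∧ (K x).1 ∈ O ∧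
      ∀ u, (fderiv ℝ K x u).2 = 0 := by
    filter_upwards [hK.eventually (by simp), hH.eventually (by simp),
      hHt.eventually (hΘ.eventually (by simp)), hHt.eventually hright, hKt.eventually hO',
      hKt.eventually hleft.eventually_nhds, hdH] with x h1 h2 h3 h4 h5 h6 h7
    have hdK : DifferentiableAt ℝ K x := h1.differentiableAt (by simp)
    refine ⟨hdK, h4, h5, fun u => ?_⟩
    obtain ⟨T, ha, hT⟩ := h7 u
    obtain ⟨v, hv⟩ := hT _ h5
    -- `T H = T f (1 + S s)`, and `T f` is a derivative of `f`: the velocity of `H` lies along the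
    -- slice.
    have h8 : fderiv ℝ H x u = fderiv ℝ Ψ (K x) (v, 0) := by
      rw [hΨ' _ h5, ha, hv, map_zero, ContinuousLinearMap.comp_zero, zero_add, ContinuousLinearMap.comp_assoc]
      exact congrArg _ h4.symm
    have h9 : HasFDerivAt K (fderiv ℝ Θ (H x) ∘L fderiv ℝ H x) x :=
      HasFDerivAt.comp x (h3.differentiableAt (by simp)).hasFDerivAt
        (h2.differentiableAt (by simp)).hasFDerivAt
    have h10 : HasFDerivAt (Θ ∘ Ψ) (fderiv ℝ Θ (H x) ∘L fderiv ℝ Ψ (K x)) (K x) := by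
      refine HasFDerivAt.comp (K x) ?_ ((hΨd _ h5).differentiableAt (by simp)).hasFDerivAt
      rw [h4]
      exact (h3.differentiableAt (by simp)).hasFDerivAt
    have h11 : HasFDerivAt (Θ ∘ Ψ) (ContinuousLinearMap.id ℝ (X × V)) (K x) :=
      (hasFDerivAt_id (K x)).congr_of_eventuallyEq h6
    rw [h9.fderiv, ContinuousLinearMap.comp_apply, h8, ← ContinuousLinearMap.comp_apply,
      h10.unique h11]
    rfl
  obtain ⟨ε, hε, hball⟩ := Metric.eventually_nhds_iff_ball.1 hev
  -- The transverse coordinate has zero derivative on a ball and vanishes at the centre, so `H`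
  -- never leaves the slice of `f`.
  have hs0 : ∀ x ∈ Metric.ball x₀ ε, (K x).2 = 0 := by
    intro x hx
    have h1 := (Metric.isOpen_ball (x := x₀) (ε := ε)).is_const_of_fderiv_eq_zero (𝕜 := ℝ)
      (f := fun x => (K x).2) (convex_ball x₀ ε).isPreconnected
      (fun x hx => (hball x hx).1.snd.differentiableWithinAt)
      (fun x hx => by
        ext1 u
        have h2 : HasFDerivAt (fun x => (K x).2)
            (ContinuousLinearMap.snd ℝ (X) V ∘L fderiv ℝ K x) x :=
          (hball x hx).1.hasFDerivAt.snd
        rw [h2.fderiv]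
        exact (hball x hx).2.2.2 u) hx (Metric.mem_ball_self hε)
    rw [h1, hK₀]
  refine ⟨fun x => (K x).1, hK.fst, congrArg Prod.fst hK₀, ?_⟩
  filter_upwards [Metric.ball_mem_nhds x₀ hε] with x hx
  rw [← (hball x hx).2.1]
  simp only [Ψ, hs0 x hx, map_zero, add_zero, ContinuousLinearMap.comp_id]

end Slice

/-! ### Lifting matrix-valued maps to the immersed group -/

section Lift

set_option linter.unusedSectionVars false

variable {n r : ℕ} {G : Type*} [TopologicalSpace G] [ChartedSpace (E r) G] [Group G]
  [LieGroup (𝓡 r) ω G] {ι : G →* (E n ≃L[ℝ] E n)}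
  (b : Module.Basis (Fin r) ℝ (GroupLieAlgebra (𝓡 r) G))

/-- `ι` in the preferred chart at the identity. -/
def toEndChart (r : ℕ) [ChartedSpace (E r) G] (ι : G →* (E n ≃L[ℝ] E n)) : E r → (E n →L[ℝ] E n) :=
  toEnd ι ∘ (extChartAt (𝓡 r) (1 : G)).symm

theorem contDiffAt_toEndChart (hι : IsLieSubgroup (r := r) ι) {y : E r}
    (hy : y ∈ (extChartAt (𝓡 r) (1 : G)).target) : ContDiffAt ℝ ω (toEndChart r ι) y := by
  have : IsManifold (𝓡 r) ω G := ContMDiffMul.toIsManifold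
  refine ContMDiffAt.contDiffAt ?_
  refine (hι.analytic _).comp y ?_
  exact (contMDiffOn_extChartAt_symm (n := ω) (1 : G)).contMDiffAt
    ((isOpen_extChartAt_target (I := 𝓡 r) (1 : G)).mem_nhds hy)

theorem fderiv_toEndChart_comp (hι : IsLieSubgroup (r := r) ι) {g : G}
    (hg : g ∈ (extChartAt (𝓡 r) (1 : G)).source) (w : E r) :
    (mfderiv (𝓡 r) 𝓘(ℝ, E n →L[ℝ] E n) (toEnd ι) g : E r →L[ℝ] (E n →L[ℝ] E n)) w =
      fderiv ℝ (toEndChart r ι) (extChartAt (𝓡 r) (1 : G) g)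
        ((mfderiv (𝓡 r) 𝓘(ℝ, E r) (extChartAt (𝓡 r) (1 : G)) g : E r →L[ℝ] E r) w) := by
  have : IsManifold (𝓡 r) ω G := ContMDiffMul.toIsManifold
  have h1 : toEnd ι =ᶠ[𝓝 g] toEndChart r ι ∘ extChartAt (𝓡 r) (1 : G) := by
    filter_upwards [(isOpen_extChartAt_source (I := 𝓡 r) (1 : G)).mem_nhds hg] with a ha
    rw [Function.comp_apply, toEndChart, Function.comp_apply,
      (extChartAt (𝓡 r) (1 : G)).left_inv ha]
  have h2 : MDifferentiableAt (𝓡 r) 𝓘(ℝ, E r) (extChartAt (𝓡 r) (1 : G)) g :=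
    (contMDiffAt_extChartAt' (n := ω) (by simpa using hg)).mdifferentiableAt (by simp)
  have h3 : DifferentiableAt ℝ (toEndChart r ι) (extChartAt (𝓡 r) (1 : G) g) :=
    (contDiffAt_toEndChart hι ((extChartAt (𝓡 r) (1 : G)).map_source hg)).differentiableAt
      (by simp)
  have h4 := (HasMFDerivAt.comp g (I' := 𝓘(ℝ, E r)) (hg := h3.hasFDerivAt.hasMFDerivAt)
    (hf := h2.hasMFDerivAt)).mfderiv
  rw [← h1.mfderiv_eq] at h4
  exact DFunLike.congr_fun h4 w

theorem exists_fderiv_toEndChart_eq (hι : IsLieSubgroup (r := r) ι) {y : E r}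
    (hy : y ∈ (extChartAt (𝓡 r) (1 : G)).target) (a : Fin r → ℝ) :
    ∃ v, fderiv ℝ (toEndChart r ι) y v = (∑ κ, a κ • F ι b κ) ∘L toEndChart r ι y := by
  set g := (extChartAt (𝓡 r) (1 : G)).symm y with hg
  have hgs : g ∈ (extChartAt (𝓡 r) (1 : G)).source := (extChartAt (𝓡 r) (1 : G)).map_target hy
  obtain ⟨w, hw⟩ := (alphaLin_bijective b g).2 a
  have h1 := fderiv_toEndChart_comp hι hgs w
  rw [mfderiv_toEnd b hι, (extChartAt (𝓡 r) (1 : G)).right_inv hy] at h1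
  refine ⟨_, h1.symm.trans ?_⟩
  rw [← hw]
  rfl

/-- The derivative of `ι` factors through that of the chart. Its injectivity makes the latter
injective, hence surjective by dimension, so injectivity passes to the remaining factor. -/
theorem fderiv_toEndChart_injective (hι : IsLieSubgroup (r := r) ι) :
    Function.Injective
      (fderiv ℝ (toEndChart r ι) (extChartAt (𝓡 r) (1 : G) (1 : G))) := by
  set T : E r →L[ℝ] E r := mfderiv (𝓡 r) 𝓘(ℝ, E r) (extChartAt (𝓡 r) (1 : G)) (1 : G) with hT
  have h1 : ∀ w, (mfderiv (𝓡 r) 𝓘(ℝ, E n →L[ℝ] E n) (toEnd ι) (1 : G) :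
      E r →L[ℝ] (E n →L[ℝ] E n)) w =
      fderiv ℝ (toEndChart r ι) (extChartAt (𝓡 r) (1 : G) (1 : G)) (T w) :=
    fun w => fderiv_toEndChart_comp hι (mem_extChartAt_source (I := 𝓡 r) (1 : G)) w
  have hinj : Function.Injective T := fun w w' hw => hι.immersive 1 <| by
    refine (h1 w).trans (Eq.trans ?_ (h1 w').symm)
    rw [hw]
  have hsurj : Function.Surjective T :=
    (LinearMap.injective_iff_surjective (f := T.toLinearMap)).1 hinj
  intro v v' hv
  obtain ⟨w, rfl⟩ := hsurj v
  obtain ⟨w', rfl⟩ := hsurj v'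
  rw [hι.immersive 1 (((h1 w).trans hv).trans (h1 w').symm)]

/-- An analytic map to matrices which is tangent to the right-invariant distribution given by the
Lie algebra of `G` and takes the value `1` lifts, locally, to `G`. -/
theorem exists_lift_one (hι : IsLieSubgroup (r := r) ι) {H : E n → E n →L[ℝ] E n} {x₀ : E n}
    (hH : ContDiffAt ℝ ω H x₀) (h₀ : H x₀ = ContinuousLinearMap.id ℝ (E n))
    (hdH : ∀ᶠ x in 𝓝 x₀, ∀ u, ∃ a : Fin r → ℝ,
      fderiv ℝ H x u = (∑ κ, a κ • F ι b κ) ∘L H x) :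
    ∃ h : E n → G, ContMDiffAt 𝓘(ℝ, E n) (𝓡 r) ω h x₀ ∧ ∀ᶠ x in 𝓝 x₀, H x = toEnd ι (h x) := by
  have : IsManifold (𝓡 r) ω G := ContMDiffMul.toIsManifold
  set c := extChartAt (𝓡 r) (1 : G) with hc
  set f := toEndChart r ι with hf
  set y₀ : E r := c 1 with hy₀_def
  have hy₀ : y₀ ∈ c.target := c.map_source (mem_extChartAt_source (I := 𝓡 r) (1 : G))
  have htgt : c.target ∈ 𝓝 y₀ :=
    (isOpen_extChartAt_target (I := 𝓡 r) (1 : G)).mem_nhds hy₀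
  have hfy₀ : f y₀ = ContinuousLinearMap.id ℝ (E n) := by
    simp [hf, toEndChart, hy₀_def, hc, toEnd_one]
  obtain ⟨V, hbij⟩ := exists_bijective_add _ (fderiv_toEndChart_injective (n := n) hι)
  obtain ⟨k, hk, hk₀, hHk⟩ := exists_factorization htgt
    (fun y hy => contDiffAt_toEndChart hι hy) hfy₀ V.subtypeL hbij hH h₀ (by
      filter_upwards [hdH] with x hx u
      obtain ⟨a, ha⟩ := hx u
      exact ⟨_, ha, fun y hy => exists_fderiv_toEndChart_eq b hι hy a⟩)
  refine ⟨fun x => c.symm (k x), ?_, hHk⟩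
  refine ContMDiffAt.comp x₀ (I' := 𝓘(ℝ, E r)) ?_ hk.contMDiffAt
  refine (contMDiffOn_extChartAt_symm (n := ω) (1 : G)).contMDiffAt ?_
  rw [hk₀]
  exact htgt

/-- An analytic map to matrices which is tangent to the right-invariant distribution given by the
Lie algebra of `G` and meets `G` lifts, locally, to `G`. -/
theorem exists_lift (hι : IsLieSubgroup (r := r) ι) {H : E n → E n →L[ℝ] E n} {x₀ : E n} {h₀ : G}
    (hH : ContDiffAt ℝ ω H x₀) (hx₀ : H x₀ = toEnd ι h₀)
    (hdH : ∀ᶠ x in 𝓝 x₀, ∀ u, ∃ a : Fin r → ℝ,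
      fderiv ℝ H x u = (∑ κ, a κ • F ι b κ) ∘L H x) :
    ∃ h : E n → G, ContMDiffAt 𝓘(ℝ, E n) (𝓡 r) ω h x₀ ∧ ∀ᶠ x in 𝓝 x₀, H x = toEnd ι (h x) := by
  -- Right translation by `h₀⁻¹` preserves the distribution and moves the value at `x₀` to the
  -- identity.
  let R : (E n →L[ℝ] E n) →L[ℝ] (E n →L[ℝ] E n) :=
    (ContinuousLinearMap.compL ℝ (E n) (E n) (E n)).flip (toEnd ι h₀⁻¹)
  have hR : ∀ T, R T = T ∘L toEnd ι h₀⁻¹ := fun T => rfl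
  obtain ⟨h, hh, hh'⟩ := exists_lift_one b hι (H := fun x => R (H x)) (x₀ := x₀)
    (R.contDiff.contDiffAt.comp x₀ hH)
    (by rw [hR, hx₀, ← toEnd_mul, mul_inv_cancel, toEnd_one]) (by
      filter_upwards [hdH, hH.eventually (by simp)] with x hx hx' u
      obtain ⟨a, ha⟩ := hx u
      refine ⟨a, ?_⟩
      have h1 : HasFDerivAt (fun x => R (H x)) (R ∘L fderiv ℝ H x) x :=
        HasFDerivAt.comp x R.hasFDerivAt (hx'.differentiableAt (by simp)).hasFDerivAt
      rw [h1.fderiv, ContinuousLinearMap.comp_apply, ha, hR, hR,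
        ContinuousLinearMap.comp_assoc])
  refine ⟨fun x => h x * h₀, (contMDiff_mul_right (I := 𝓡 r) (n := ω) (a := h₀)).contMDiffAt.comp
    x₀ hh, ?_⟩
  filter_upwards [hh'] with x hx
  rw [toEnd_mul, ← hx, hR, ContinuousLinearMap.comp_assoc, ← toEnd_mul, inv_mul_cancel, toEnd_one,
    ContinuousLinearMap.comp_id]

end Lift

/-! ### Analytic local diffeomorphisms of `ℝⁿ` -/

section LocalDiffeomorph

variable {n : ℕ}

/-- The analytic inverse function theorem. -/
theorem isLocalDiffeomorphOn_of_injective_fderiv {φ : E n → E n} {U : Set (E n)} (hU : IsOpen U)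
    (hφ : ContDiffOn ℝ ω φ U) (hinj : ∀ x ∈ U, Function.Injective (fderiv ℝ φ x)) :
    IsLocalDiffeomorphOn 𝓘(ℝ, E n) 𝓘(ℝ, E n) ω φ U := by
  have hat : ∀ x ∈ U, ContDiffAt ℝ ω φ x := fun x hx => hφ.contDiffAt (hU.mem_nhds hx)
  have hder : ∀ x ∈ U, ∃ T : E n ≃L[ℝ] E n, HasFDerivAt φ (T : E n →L[ℝ] E n) x := fun x hx =>
    ⟨(LinearEquiv.ofInjectiveEndo (fderiv ℝ φ x).toLinearMap
      (hinj x hx)).toContinuousLinearEquiv,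
      ((hat x hx).differentiableAt (by simp)).hasFDerivAt⟩
  rintro ⟨x, hx⟩
  obtain ⟨T, hT⟩ := hder x hx
  let R := ((hat x hx).toOpenPartialHomeomorph φ hT (by simp)).restrOpen U hU
  have hRs : ∀ y ∈ R.source, y ∈ U := fun y hy => by
    rw [OpenPartialHomeomorph.restrOpen_source] at hy
    exact hy.2
  refine ⟨{ R.toPartialEquiv with
    open_source := R.open_source
    open_target := R.open_target
    contMDiffOn_toFun := fun y hy => (hat y (hRs y hy)).contMDiffAt.contMDiffWithinAt
    contMDiffOn_invFun := fun y hy => by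
      obtain ⟨T', hT'⟩ := hder _ (hRs _ (R.map_target hy))
      exact (R.contDiffAt_symm hy hT' (hat _ (hRs _ (R.map_target hy)))).contMDiffAt.contMDiffWithinAt
    }, ?_, fun y _ => rfl⟩
  change x ∈ R.source
  rw [OpenPartialHomeomorph.restrOpen_source]
  exact ⟨(hat x hx).mem_toOpenPartialHomeomorph_source hT (by simp), hx⟩

theorem fderiv_bijective_of_isLocalDiffeomorphAt {φ : E n → E n} {x : E n}
    (h : IsLocalDiffeomorphAt 𝓘(ℝ, E n) 𝓘(ℝ, E n) ω φ x) :
    Function.Bijective (fderiv ℝ φ x) := by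
  rw [← mfderiv_eq_fderiv]
  exact (h.mfderivToContinuousLinearEquiv (by simp)).bijective

theorem contDiffAt_cartanMatrix {A : E n → E n ≃L[ℝ] E n}
    (hA : ContDiff ℝ ω fun x => (A x : E n →L[ℝ] E n)) {φ : E n → E n} {x : E n}
    (hφ : ContDiffAt ℝ ω φ x) : ContDiffAt ℝ ω (cartanMatrix A φ) x := by
  have h1 : ContDiffAt ℝ ω (fun x => ((A x).symm : E n →L[ℝ] E n)) x := by
    have h2 := (contDiffAt_map_inverse (𝕜 := ℝ) (n := ω) (A x)).comp x hA.contDiffAt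
    refine h2.congr_of_eventuallyEq (Filter.Eventually.of_forall fun y => ?_)
    exact (ContinuousLinearMap.inverse_equiv (A y)).symm
  exact (hA.contDiffAt.comp x hφ).clm_comp ((hφ.fderiv_right (by simp)).clm_comp h1)

end LocalDiffeomorph


/-! ### The right action of first jets and its derivative -/

section RightAction

set_option linter.unusedSectionVars false

variable {n r : ℕ} {G : Type*} [TopologicalSpace G] [ChartedSpace (E r) G] [Group G]
  [LieGroup (𝓡 r) ω G] {ι : G →* (E n ≃L[ℝ] E n)} {A : E n → E n ≃L[ℝ] E n}
  {b : Module.Basis (Fin r) ℝ (GroupLieAlgebra (𝓡 r) G)}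

theorem cartanMatrix_eq_iff (φ : E n → E n) (x : E n) (h : G) :
    cartanMatrix A φ x = toEnd ι h ↔ ∀ u, A (φ x) (fderiv ℝ φ x u) = ι h (A x u) := by
  constructor
  · intro H u
    have := DFunLike.congr_fun H (A x u)
    simpa [cartanMatrix, toEnd_apply] using this
  · intro H
    ext1 u
    have := H ((A x).symm u)
    simpa [cartanMatrix, toEnd_apply] using this

theorem HasSecondJet.cartanMatrix_eq {φ : E n → E n} {x : E n} {h : G} {z : Fin r × Fin n → ℝ}
    (H : HasSecondJet ι A b φ x h z) : cartanMatrix A φ x = toEnd ι h :=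
  (cartanMatrix_eq_iff φ x h).2 H.1

/-- The factors of `A` cancel from the Jacobians. The remaining matrix identity can be
differentiated without knowing that the Cartan matrix lifts smoothly to `G`. -/
theorem isRightAction_iff (φ : E n → E n) (p q : G1 n G) :
    IsRightAction ι A φ p q ↔ q.1 = φ p.1 ∧ q.2.1 = p.2.1 ∧
      toEnd ι q.2.2 ∘L cartanMatrix A φ p.1 = toEnd ι p.2.2 := by
  refine and_congr_right fun h1 => and_congr_right fun h2 => ?_
  rw [jacobian, jacobian, h1, h2]
  constructor
  · intro H
    ext1 u
    have := congrArg (A p.2.1) (DFunLike.congr_fun H ((A p.1).symm u))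
    simpa [cartanMatrix] using this
  · intro H
    ext1 u
    have := congrArg (A p.2.1).symm (DFunLike.congr_fun H (A p.1 u))
    simpa [cartanMatrix] using this

/-- The components of the derivative of a map into `𝒢₁`. -/
theorem hasMFDerivAt_components {Φ : G1 n G → G1 n G} {p : G1 n G}
    (hΦ : MDifferentiableAt (I1 n r) (I1 n r) Φ p) {L : T1 n r →L[ℝ] T1 n r}
    (hL : L = mfderiv (I1 n r) (I1 n r) Φ p) :
    HasMFDerivAt (I1 n r) 𝓘(ℝ, E n) (fun q => (Φ q).1) p
      (ContinuousLinearMap.fst ℝ (E n) (E n × E r) ∘L L) ∧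
    HasMFDerivAt (I1 n r) 𝓘(ℝ, E n) (fun q => (Φ q).2.1) p
      (ContinuousLinearMap.fst ℝ (E n) (E r) ∘L ContinuousLinearMap.snd ℝ (E n) (E n × E r) ∘L L) ∧
    HasMFDerivAt (I1 n r) (𝓡 r) (fun q => (Φ q).2.2) p
      (ContinuousLinearMap.snd ℝ (E n) (E r) ∘L
        ContinuousLinearMap.snd ℝ (E n) (E n × E r) ∘L L) := by
  subst hL
  refine ⟨?_, ?_, ?_⟩
  · exact HasMFDerivAt.comp p (hasMFDerivAt_fst (Φ p)) hΦ.hasMFDerivAt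
  · exact HasMFDerivAt.comp p (hasMFDerivAt_fst (Φ p).2)
      (HasMFDerivAt.comp p (hasMFDerivAt_snd (Φ p)) hΦ.hasMFDerivAt)
  · exact HasMFDerivAt.comp p (hasMFDerivAt_snd (Φ p).2)
      (HasMFDerivAt.comp p (hasMFDerivAt_snd (Φ p)) hΦ.hasMFDerivAt)

theorem hasMFDerivAt_source (p : G1 n G) :
    HasMFDerivAt (I1 n r) 𝓘(ℝ, E n) (fun q : G1 n G => q.1) p
      (ContinuousLinearMap.fst ℝ (E n) (E n × E r)) :=
  hasMFDerivAt_fst p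

theorem hasMFDerivAt_target (p : G1 n G) :
    HasMFDerivAt (I1 n r) 𝓘(ℝ, E n) (fun q : G1 n G => q.2.1) p
      (ContinuousLinearMap.fst ℝ (E n) (E r) ∘L ContinuousLinearMap.snd ℝ (E n) (E n × E r)) :=
  HasMFDerivAt.comp p (hasMFDerivAt_fst p.2) (hasMFDerivAt_snd p)

theorem hasMFDerivAt_group (p : G1 n G) :
    HasMFDerivAt (I1 n r) (𝓡 r) (fun q : G1 n G => q.2.2) p
      (ContinuousLinearMap.snd ℝ (E n) (E r) ∘L ContinuousLinearMap.snd ℝ (E n) (E n × E r)) :=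
  HasMFDerivAt.comp p (hasMFDerivAt_snd p.2) (hasMFDerivAt_snd p)

/-- The derivative of a map that covers `φ`. -/
theorem deriv_fst_of_eventuallyEq {Φ : G1 n G → G1 n G} {p : G1 n G}
    (hΦ : MDifferentiableAt (I1 n r) (I1 n r) Φ p) {L : T1 n r →L[ℝ] T1 n r}
    (hL : L = mfderiv (I1 n r) (I1 n r) Φ p) {φ : E n → E n} (hφ : DifferentiableAt ℝ φ p.1)
    (h : ∀ᶠ q in 𝓝 p, (Φ q).1 = φ q.1) (w : T1 n r) : (L w).1 = fderiv ℝ φ p.1 w.1 := by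
  have h1 := (hasMFDerivAt_components hΦ hL).1
  have h2 : HasMFDerivAt (I1 n r) 𝓘(ℝ, E n) (fun q : G1 n G => φ q.1) p
      (fderiv ℝ φ p.1 ∘L ContinuousLinearMap.fst ℝ (E n) (E n × E r)) :=
    HasMFDerivAt.comp p hφ.hasFDerivAt.hasMFDerivAt (hasMFDerivAt_source p)
  exact DFunLike.congr_fun (hasMFDerivAt_unique h1 (h2.congr_of_eventuallyEq h)) w

theorem deriv_of_isRightAction (hι : IsLieSubgroup (r := r) ι)
    (hA : ContDiff ℝ ω fun x => (A x : E n →L[ℝ] E n)) {Φ : G1 n G → G1 n G} {p : G1 n G}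
    (hΦ : MDifferentiableAt (I1 n r) (I1 n r) Φ p) {L : T1 n r →L[ℝ] T1 n r}
    (hL : L = mfderiv (I1 n r) (I1 n r) Φ p) {φ : E n → E n} (hφ : ContDiffAt ℝ ω φ p.1)
    (h : ∀ᶠ q in 𝓝 p, IsRightAction ι A φ q (Φ q)) (w : T1 n r) :
    (L w).1 = fderiv ℝ φ p.1 w.1 ∧ (L w).2.1 = w.2.1 ∧
      (∑ κ, alpha b κ (Φ p).2.2 (L w).2.2 • F ι b κ) ∘L toEnd ι p.2.2 =
        (∑ κ, alpha b κ p.2.2 w.2.2 • F ι b κ) ∘L toEnd ι p.2.2 -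
          toEnd ι (Φ p).2.2 ∘L fderiv ℝ (cartanMatrix A φ) p.1 w.1 := by
  simp only [isRightAction_iff] at h
  obtain ⟨h1, h2, h3⟩ := hasMFDerivAt_components hΦ hL
  refine ⟨deriv_fst_of_eventuallyEq hΦ hL (hφ.differentiableAt (by simp)) (h.mono fun _ h => h.1) w,
    ?_, ?_⟩
  · exact DFunLike.congr_fun (hasMFDerivAt_unique h2
      ((hasMFDerivAt_target p).congr_of_eventuallyEq (h.mono fun _ h => h.2.1))) w
  · have hH : DifferentiableAt ℝ (cartanMatrix A φ) p.1 :=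
      (contDiffAt_cartanMatrix hA hφ).differentiableAt (by simp)
    let T : T1 n r →L[ℝ] (E n →L[ℝ] E n) :=
      (show E r →L[ℝ] (E n →L[ℝ] E n) from
        mfderiv (𝓡 r) 𝓘(ℝ, E n →L[ℝ] E n) (toEnd ι) (Φ p).2.2) ∘L
      (ContinuousLinearMap.snd ℝ (E n) (E r) ∘L ContinuousLinearMap.snd ℝ (E n) (E n × E r) ∘L L)
    have h4 : HasMFDerivAt (I1 n r) 𝓘(ℝ, E n →L[ℝ] E n) (fun q => toEnd ι (Φ q).2.2) p T :=
      HasMFDerivAt.comp (g := toEnd ι) p (mdifferentiable_toEnd hι _).hasMFDerivAt h3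
    let T' : T1 n r →L[ℝ] (E n →L[ℝ] E n) :=
      fderiv ℝ (cartanMatrix A φ) p.1 ∘L ContinuousLinearMap.fst ℝ (E n) (E n × E r)
    have h5 : HasMFDerivAt (I1 n r) 𝓘(ℝ, E n →L[ℝ] E n)
        (fun q : G1 n G => cartanMatrix A φ q.1) p T' :=
      HasMFDerivAt.comp p hH.hasFDerivAt.hasMFDerivAt (hasMFDerivAt_source p)
    -- Product rule for `g' H = g`, with `g'` the group coordinate of the image and `H` the Cartan
    -- matrix; the Maurer-Cartan identity then rewrites `dg'` and `dg`.
    have h6 : HasMFDerivAt (I1 n r) 𝓘(ℝ, E n →L[ℝ] E n)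
        (fun q => toEnd ι (Φ q).2.2 * cartanMatrix A φ q.1) p _ := HasMFDerivAt.mul' h4 h5
    have h7 : HasMFDerivAt (I1 n r) 𝓘(ℝ, E n →L[ℝ] E n) (fun q : G1 n G => toEnd ι q.2.2) p _ :=
      HasMFDerivAt.comp (g := toEnd ι) p (mdifferentiable_toEnd hι _).hasMFDerivAt (hasMFDerivAt_group p)
    have h8 := DFunLike.congr_fun (hasMFDerivAt_unique h6
      (h7.congr_of_eventuallyEq (h.mono fun _ h => h.2.2))) w
    have h9 : toEnd ι (Φ p).2.2 ∘L fderiv ℝ (cartanMatrix A φ) p.1 w.1 +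
        (mfderiv (𝓡 r) 𝓘(ℝ, E n →L[ℝ] E n) (toEnd ι) (Φ p).2.2 : E r →L[ℝ] (E n →L[ℝ] E n))
          (L w).2.2 ∘L cartanMatrix A φ p.1 =
        (mfderiv (𝓡 r) 𝓘(ℝ, E n →L[ℝ] E n) (toEnd ι) p.2.2 : E r →L[ℝ] (E n →L[ℝ] E n))
          w.2.2 := h8
    rw [mfderiv_toEnd b hι, mfderiv_toEnd b hι, ContinuousLinearMap.comp_assoc,
      h.self_of_nhds.2.2] at h9
    rw [← h9]
    abel

theorem comp_toEnd_injective (g : G) {T T' : E n →L[ℝ] E n}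
    (h : T ∘L toEnd ι g = T' ∘L toEnd ι g) : T = T' := by
  ext1 u
  have := DFunLike.congr_fun h (ι g⁻¹ u)
  simpa only [ContinuousLinearMap.comp_apply, toEnd_apply, apply_inv_apply] using this

theorem toEnd_comp_injective (g : G) {T T' : E n →L[ℝ] E n}
    (h : toEnd ι g ∘L T = toEnd ι g ∘L T') : T = T' := by
  ext1 u
  exact (ι g).injective (DFunLike.congr_fun h u)

/-- The jets of a right action are those determined by the second order jets. -/
theorem isActionJet_of_hasSecondJet (hι : IsLieSubgroup (r := r) ι)
    (hA : ContDiff ℝ ω fun x => (A x : E n →L[ℝ] E n)) {Φ : G1 n G → G1 n G} {p : G1 n G}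
    (hΦ : MDifferentiableAt (I1 n r) (I1 n r) Φ p) {φ : E n → E n} (hφ : ContDiffAt ℝ ω φ p.1)
    (h : ∀ᶠ q in 𝓝 p, IsRightAction ι A φ q (Φ q)) {k : G} {z : Fin r × Fin n → ℝ}
    (hz : HasSecondJet ι A b φ p.1 k z) :
    IsActionJet ι A b (φ p.1) k z p (Φ p) (mfderiv (I1 n r) (I1 n r) Φ p) := by
  have hp := (isRightAction_iff ..).1 h.self_of_nhds
  have hg : (Φ p).2.2 = p.2.2 * k⁻¹ := by
    have := hp.2.2
    rw [hz.cartanMatrix_eq, ← toEnd_mul] at this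
    rw [← toEnd_injective hι this, mul_inv_cancel_right]
  have hq : Φ p = (φ p.1, p.2.1, p.2.2 * k⁻¹) := Prod.ext hp.1 (Prod.ext hp.2.1 hg)
  refine ⟨hq, fun w => ?_⟩
  obtain ⟨h1, h2, h3⟩ := deriv_of_isRightAction (b := b) hι hA hΦ rfl hφ h w
  refine ⟨?_, h2, comp_toEnd_injective (ι := ι) p.2.2 (h3.trans ?_)⟩
  · exact (congrArg (A (φ p.1)) h1).trans (hz.1 _)
  · rw [hz.2, ContinuousLinearMap.sub_comp, hg, ContinuousLinearMap.comp_assoc,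
      ContinuousLinearMap.comp_assoc, ← toEnd_mul, mul_inv_rev, inv_inv, inv_mul_cancel_right]

/-- The derivative formula for a right action, evaluated on `(u, 0, 0)` and solved for the
derivative of the Cartan matrix. -/
theorem hasSecondJet_of_isActionJet (hι : IsLieSubgroup (r := r) ι)
    (hA : ContDiff ℝ ω fun x => (A x : E n →L[ℝ] E n)) {Φ : G1 n G → G1 n G} {p : G1 n G}
    (hΦ : MDifferentiableAt (I1 n r) (I1 n r) Φ p) {φ : E n → E n} (hφ : ContDiffAt ℝ ω φ p.1)
    (h : ∀ᶠ q in 𝓝 p, IsRightAction ι A φ q (Φ q)) {k : G} {z : Fin r × Fin n → ℝ}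
    (hz : IsActionJet ι A b (φ p.1) k z p (Φ p) (mfderiv (I1 n r) (I1 n r) Φ p)) :
    HasSecondJet ι A b φ p.1 k z := by
  obtain ⟨hq, hw⟩ := hz
  have hg : (Φ p).2.2 = p.2.2 * k⁻¹ := congrArg (fun q : G1 n G => q.2.2) hq
  refine ⟨fun u => ?_, fun u => ?_⟩
  · obtain ⟨h1, -, -⟩ := deriv_of_isRightAction (b := b) hι hA hΦ rfl hφ h (u, 0, 0)
    exact (congrArg (A (φ p.1)) h1).symm.trans (hw (u, 0, 0)).1
  · obtain ⟨-, -, h3⟩ := deriv_of_isRightAction (b := b) hι hA hΦ rfl hφ h (u, 0, 0)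
    have h4 := (hw (u, 0, 0)).2.2
    have h5 := h3.symm.trans (congrArg (fun T : E n →L[ℝ] E n => T ∘L toEnd ι p.2.2) h4)
    simp only [ContinuousLinearMap.sub_comp] at h5
    have h6 := sub_right_injective h5
    rw [hg, ContinuousLinearMap.comp_assoc, ContinuousLinearMap.comp_assoc, ← toEnd_mul,
      mul_inv_rev, inv_inv, inv_mul_cancel_right] at h6
    exact toEnd_comp_injective (ι := ι) _ h6

/-- The 2-jets supply group elements only pointwise. They also supply tangency to the Lie algebra,
which yields an analytic local lift; injectivity of `ι` forces the pointwise choice to agree with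
it. -/
theorem SolvesG11.exists_lift (hι : IsLieSubgroup (r := r) ι)
    (hA : ContDiff ℝ ω fun x => (A x : E n →L[ℝ] E n)) {φ : E n → E n} {U : Set (E n)}
    (hU : IsOpen U) (hφ : ContDiffOn ℝ ω φ U) (h : SolvesG11 ι A b φ U) :
    ∃ k : E n → G, (∀ x ∈ U, cartanMatrix A φ x = toEnd ι (k x)) ∧
      ContMDiffOn 𝓘(ℝ, E n) (𝓡 r) ω k U := by
  have h1 : ∀ x, ∃ k : G, x ∈ U → cartanMatrix A φ x = toEnd ι k := fun x => by
    by_cases hx : x ∈ U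
    · obtain ⟨k, z, hz, -⟩ := h x hx
      exact ⟨k, fun _ => hz.cartanMatrix_eq⟩
    · exact ⟨1, fun hx' => absurd hx' hx⟩
  choose k hk using h1
  refine ⟨k, hk, fun x hx => ?_⟩
  obtain ⟨k', hk', hk''⟩ := CartanProlongation.exists_lift b hι (h₀ := k x)
    (contDiffAt_cartanMatrix hA (hφ.contDiffAt (hU.mem_nhds hx))) (hk x hx) (by
      filter_upwards [hU.mem_nhds hx] with y hy u
      obtain ⟨k'', z, hz, -⟩ := h y hy
      exact ⟨_, by rw [hz.2 u, hz.cartanMatrix_eq]⟩)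
  refine (hk'.congr_of_eventuallyEq ?_).contMDiffWithinAt
  filter_upwards [hk'', hU.mem_nhds hx] with y hy hyU
  exact toEnd_injective hι ((hk y hyU).symm.trans hy)

/-- The right action `(x, X, g) ↦ (φ(x), X, g k(x)⁻¹)`. -/
def actionMap (φ : E n → E n) (k : E n → G) (p : G1 n G) : G1 n G :=
  (φ p.1, p.2.1, p.2.2 * (k p.1)⁻¹)

theorem contMDiffOn_actionMap {φ : E n → E n} {k : E n → G} {U : Set (E n)}
    (hφ : ContMDiffOn 𝓘(ℝ, E n) 𝓘(ℝ, E n) ω φ U) (hk : ContMDiffOn 𝓘(ℝ, E n) (𝓡 r) ω k U) :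
    ContMDiffOn (I1 n r) (I1 n r) ω (actionMap φ k) (Prod.fst ⁻¹' U) := by
  have h1 : ContMDiffOn (I1 n r) 𝓘(ℝ, E n) ω (Prod.fst : G1 n G → E n) (Prod.fst ⁻¹' U) :=
    contMDiff_fst.contMDiffOn
  have h2 : ContMDiffOn (I1 n r) (𝓘(ℝ, E n).prod (𝓡 r)) ω (Prod.snd : G1 n G → E n × G)
    (Prod.fst ⁻¹' U) := contMDiff_snd.contMDiffOn
  have h3 : ContMDiffOn (I1 n r) 𝓘(ℝ, E n) ω (fun p : G1 n G => p.2.1) (Prod.fst ⁻¹' U) :=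
    contMDiff_fst.comp_contMDiffOn h2
  have h4 : ContMDiffOn (I1 n r) (𝓡 r) ω (fun p : G1 n G => p.2.2) (Prod.fst ⁻¹' U) :=
    contMDiff_snd.comp_contMDiffOn h2
  exact (hφ.comp h1 fun p hp => hp).prodMk
    (h3.prodMk (h4.mul (hk.comp h1 fun p hp => hp).inv))

theorem isRightAction_actionMap {φ : E n → E n} {k : E n → G} {p : G1 n G}
    (hk : cartanMatrix A φ p.1 = toEnd ι (k p.1)) : IsRightAction ι A φ p (actionMap φ k p) := by
  rw [isRightAction_iff]
  refine ⟨rfl, rfl, ?_⟩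
  rw [hk, ← toEnd_mul, actionMap, inv_mul_cancel_right]

theorem isLocalDiffeomorphOn_actionMap {φ : E n → E n} {k : E n → G} {U : Set (E n)}
    (hU : IsOpen U) (hφ : IsLocalDiffeomorphOn 𝓘(ℝ, E n) 𝓘(ℝ, E n) ω φ U)
    (hk : ContMDiffOn 𝓘(ℝ, E n) (𝓡 r) ω k U) :
    IsLocalDiffeomorphOn (I1 n r) (I1 n r) ω (actionMap φ k) (Prod.fst ⁻¹' U) := by
  rintro ⟨p, hp⟩
  obtain ⟨ψ, hpψ, hψ⟩ := hφ ⟨p.1, hp⟩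
  let R := ψ.toOpenPartialHomeomorph.restrOpen U hU
  have hRs : R.source = ψ.source ∩ U := OpenPartialHomeomorph.restrOpen_source _ _ _
  have hRφ : ∀ x ∈ R.source, R x = φ x := fun x hx => by
    rw [hRs] at hx
    exact (hψ hx.1).symm
  have hRU : R.source ⊆ U := fun x hx => by
    rw [hRs] at hx
    exact hx.2
  have hRc : ContMDiffOn 𝓘(ℝ, E n) 𝓘(ℝ, E n) ω R.symm R.target := by
    refine ψ.contMDiffOn_invFun.mono fun y hy => ?_
    have h1 := R.map_target hy
    rw [hRs] at h1
    have h2 := ψ.toPartialEquiv.map_source h1.1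
    have h3 : ψ.toPartialEquiv (R.symm y) = y := R.right_inv hy
    rwa [h3] at h2
  refine ⟨{
    toFun := actionMap φ k
    -- The inverse is the action of the inverse jet: `φ⁻¹` has group part `k⁻¹` at the corresponding
    -- source.
    invFun := actionMap R.symm fun y => (k (R.symm y))⁻¹
    source := Prod.fst ⁻¹' R.source
    target := Prod.fst ⁻¹' R.target
    map_source' := fun q hq => by
      have h1 := R.map_source hq
      rwa [hRφ _ hq] at h1
    map_target' := fun q hq => R.map_target hq
    left_inv' := fun q hq => by
      have h1 := R.left_inv hq
      rw [hRφ _ hq] at h1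
      simp [actionMap, h1]
    right_inv' := fun q hq => by
      have h1 := R.right_inv hq
      rw [hRφ _ (R.map_target hq)] at h1
      simp [actionMap, h1]
    open_source := R.open_source.preimage continuous_fst
    open_target := R.open_target.preimage continuous_fst
    contMDiffOn_toFun := (contMDiffOn_actionMap hφ.contMDiffOn hk).mono fun q hq => hRU hq
    contMDiffOn_invFun := contMDiffOn_actionMap hRc
      (hk.comp hRc fun y hy => hRU (R.map_target hy)).inv }, ?_, fun _ _ => rfl⟩
  change p.1 ∈ R.source
  rw [hRs]
  exact ⟨hpψ, hp⟩

namespace Absorption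

variable (D : Absorption ι A b)

theorem prolongedAt_of_isRightAction (hι : IsLieSubgroup (r := r) ι)
    (hA : ContDiff ℝ ω fun x => (A x : E n →L[ℝ] E n)) {Φ : G1 n G → G1 n G} {p : G1 n G}
    (hΦ : MDifferentiableAt (I1 n r) (I1 n r) Φ p) {φ : E n → E n} {U : Set (E n)}
    (hpU : p.1 ∈ U) (hφ : ContDiffAt ℝ ω φ p.1) (hsol : SolvesG11 ι A b φ U)
    (h : ∀ᶠ q in 𝓝 p, IsRightAction ι A φ q (Φ q)) :
    D.ProlongedAt p (Φ p) (mfderiv (I1 n r) (I1 n r) Φ p) := by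
  obtain ⟨k, z, hz, hz'⟩ := hsol p.1 hpU
  have h1 : (Φ p).1 = φ p.1 := h.self_of_nhds.1
  refine D.prolongedAt_of_isActionJet hι (h := k) (z := z) ?_ ?_
  · rwa [h1]
  · rw [h1]
    exact isActionJet_of_hasSecondJet hι hA hΦ hφ h hz

theorem exists_action (hι : IsLieSubgroup (r := r) ι)
    (hA : ContDiff ℝ ω fun x => (A x : E n →L[ℝ] E n)) {U : Set (E n)} {φ : E n → E n}
    (hU : IsOpen U) (hφ : IsLocalDiffeomorphOn 𝓘(ℝ, E n) 𝓘(ℝ, E n) ω φ U)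
    (hsol : SolvesG11 ι A b φ U) :
    ∃ Φ : G1 n G → G1 n G,
      IsLocalDiffeomorphOn (I1 n r) (I1 n r) ω Φ (Prod.fst ⁻¹' U) ∧
      (∀ q ∈ Prod.fst ⁻¹' U, IsRightAction ι A φ q (Φ q)) ∧
      D.SolvesProlonged Φ (Prod.fst ⁻¹' U) ∧
      ∀ q ∈ Prod.fst ⁻¹' U, ∀ (h : G) (z : Fin r × Fin n → ℝ), HasSecondJet ι A b φ q.1 h z →
        IsActionJet ι A b (φ q.1) h z q (Φ q) (mfderiv (I1 n r) (I1 n r) Φ q) := by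
  have hφU : ContDiffOn ℝ ω φ U := hφ.contMDiffOn.contDiffOn
  have hφat : ∀ x ∈ U, ContDiffAt ℝ ω φ x := fun x hx => hφU.contDiffAt (hU.mem_nhds hx)
  obtain ⟨k, hk, hkc⟩ := hsol.exists_lift hι hA hU hφU
  have hact : ∀ q ∈ Prod.fst ⁻¹' U, IsRightAction ι A φ q (actionMap φ k q) :=
    fun q hq => isRightAction_actionMap (hk _ hq)
  have hev : ∀ q ∈ Prod.fst ⁻¹' U, ∀ᶠ q' in 𝓝 q, IsRightAction ι A φ q' (actionMap φ k q') :=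
    fun q hq => Filter.eventually_of_mem ((hU.preimage continuous_fst).mem_nhds hq) hact
  have hd := isLocalDiffeomorphOn_actionMap hU hφ hkc
  have hmd : ∀ q ∈ Prod.fst ⁻¹' U, MDifferentiableAt (I1 n r) (I1 n r) (actionMap φ k) q :=
    fun q hq => (hd ⟨q, hq⟩).mdifferentiableAt (by simp)
  exact ⟨actionMap φ k, hd, hact,
    fun q hq => D.prolongedAt_of_isRightAction hι hA (hmd q hq) hq (hφat _ hq) hsol (hev q hq),
    fun q hq h z hz => isActionJet_of_hasSecondJet hι hA (hmd q hq) (hφat _ hq) (hev q hq) hz⟩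

end Absorption

end RightAction


/-! ### Solutions: local form and gluing -/

section Solutions

set_option linter.unusedSectionVars false

variable {n r : ℕ} {G : Type*} [TopologicalSpace G] [ChartedSpace (E r) G] [Group G]
  [LieGroup (𝓡 r) ω G] {ι : G →* (E n ≃L[ℝ] E n)} {A : E n → E n ≃L[ℝ] E n}
  {b : Module.Basis (Fin r) ℝ (GroupLieAlgebra (𝓡 r) G)}

/-- A function of `(x, y)` near `(x₀, y₀)` whose derivative vanishes in the directions of `y` does
not depend on `y`. -/
theorem eventually_eq_of_fderiv_eq_zero {X Y Z : Type*} [NormedAddCommGroup X] [NormedSpace ℝ X]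
    [NormedAddCommGroup Y] [NormedSpace ℝ Y] [NormedAddCommGroup Z] [NormedSpace ℝ Z]
    {f : X × Y → Z} {x₀ : X} {y₀ : Y}
    (h : ∀ᶠ p in 𝓝 (x₀, y₀), DifferentiableAt ℝ f p ∧ ∀ v, fderiv ℝ f p (0, v) = 0) :
    ∀ᶠ p in 𝓝 (x₀, y₀), f p = f (p.1, y₀) := by
  obtain ⟨ε, hε, hball⟩ := Metric.eventually_nhds_iff_ball.1 h
  filter_upwards [Metric.ball_mem_nhds (x₀, y₀) hε] with p hp
  rw [← ball_prod_same] at hp hball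
  refine (Metric.isOpen_ball (x := y₀) (ε := ε)).is_const_of_fderiv_eq_zero (𝕜 := ℝ)
    (f := fun y => f (p.1, y)) (convex_ball y₀ ε).isPreconnected ?_ ?_ hp.2
    (Metric.mem_ball_self hε)
  · intro y hy
    exact ((hball (p.1, y) ⟨hp.1, hy⟩).1.comp y
      (DifferentiableAt.prodMk (differentiableAt_const _) differentiableAt_id)).differentiableWithinAt
  · intro y hy
    obtain ⟨h1, h2⟩ := hball (p.1, y) ⟨hp.1, hy⟩
    have h3 : HasFDerivAt (fun y => f (p.1, y)) (fderiv ℝ f (p.1, y) ∘L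
        ContinuousLinearMap.prod 0 (ContinuousLinearMap.id ℝ Y)) y :=
      HasFDerivAt.comp y h1.hasFDerivAt ((hasFDerivAt_const _ _).prodMk (hasFDerivAt_id y))
    rw [h3.fderiv]
    ext1 v
    exact h2 v

/-- A map whose derivative kills the vectors tangent to the fibres of the source map is locally
constant on these fibres. -/
theorem eventually_eq_of_mfderiv_eq_zero {f : G1 n G → E n} {p : G1 n G}
    (h : ∀ᶠ q in 𝓝 p, ∃ T : T1 n r →L[ℝ] E n, HasMFDerivAt (I1 n r) 𝓘(ℝ, E n) f q T ∧
      ∀ w : T1 n r, w.1 = 0 → T w = 0) :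
    ∀ᶠ q in 𝓝 p, f q = f (q.1, p.2) := by
  have : IsManifold (𝓡 r) ω G := ContMDiffMul.toIsManifold
  set c := extChartAt (𝓡 r) p.2.2 with hc
  -- Only the factor `G` needs a chart; in it the fibres of the source map are the slices with fixed
  -- first component.
  let σ : E n × (E n × E r) → G1 n G := fun y => (y.1, y.2.1, c.symm y.2.2)
  have hct : c.target ∈ 𝓝 (c p.2.2) := extChartAt_target_mem_nhds p.2.2
  have hσ₀ : σ (p.1, p.2.1, c p.2.2) = p := by
    simp [σ, hc]
  have hσd : ∀ y : E n × (E n × E r), y.2.2 ∈ c.target →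
      ∃ T : E r →L[ℝ] E r, HasMFDerivAt 𝓘(ℝ, E n × (E n × E r)) (I1 n r) σ y
        ((ContinuousLinearMap.id ℝ (E n)).prodMap ((ContinuousLinearMap.id ℝ (E n)).prodMap T)) := by
    intro y hy
    have h1 : MDifferentiableAt 𝓘(ℝ, E r) (𝓡 r) c.symm y.2.2 :=
      ((contMDiffOn_extChartAt_symm (n := ω) p.2.2).contMDiffAt
        ((isOpen_extChartAt_target (I := 𝓡 r) p.2.2).mem_nhds hy)).mdifferentiableAt (by simp)
    refine ⟨mfderiv 𝓘(ℝ, E r) (𝓡 r) c.symm y.2.2, ?_⟩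
    have h2 : HasMFDerivAt 𝓘(ℝ, E n × (E n × E r)) 𝓘(ℝ, E n)
        (fun y : E n × (E n × E r) => y.1) y (ContinuousLinearMap.fst ℝ (E n) (E n × E r)) :=
      hasFDerivAt_fst.hasMFDerivAt
    have h3 : HasMFDerivAt 𝓘(ℝ, E n × (E n × E r)) 𝓘(ℝ, E n)
        (fun y : E n × (E n × E r) => y.2.1) y
        (ContinuousLinearMap.fst ℝ (E n) (E r) ∘L ContinuousLinearMap.snd ℝ (E n) (E n × E r)) :=
      (HasFDerivAt.comp y hasFDerivAt_fst hasFDerivAt_snd).hasMFDerivAt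
    have h4 : HasMFDerivAt 𝓘(ℝ, E n × (E n × E r)) 𝓘(ℝ, E r)
        (fun y : E n × (E n × E r) => y.2.2) y
        (ContinuousLinearMap.snd ℝ (E n) (E r) ∘L ContinuousLinearMap.snd ℝ (E n) (E n × E r)) :=
      (HasFDerivAt.comp y hasFDerivAt_snd hasFDerivAt_snd).hasMFDerivAt
    exact h2.prodMk (h3.prodMk (HasMFDerivAt.comp y h1.hasMFDerivAt h4))
  have hσc : ContinuousAt σ (p.1, p.2.1, c p.2.2) := by
    obtain ⟨T, hT⟩ := hσd (p.1, p.2.1, c p.2.2) (mem_of_mem_nhds hct)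
    exact hT.continuousAt
  have hσt : Filter.Tendsto σ (𝓝 (p.1, p.2.1, c p.2.2)) (𝓝 p) := by
    have := hσc.tendsto
    rwa [hσ₀] at this
  have hct' : ∀ᶠ y : E n × (E n × E r) in 𝓝 (p.1, p.2.1, c p.2.2), y.2.2 ∈ c.target :=
    (continuous_snd.comp continuous_snd).continuousAt.eventually hct
  have key := eventually_eq_of_fderiv_eq_zero (f := f ∘ σ) (x₀ := p.1) (y₀ := (p.2.1, c p.2.2)) (by
    filter_upwards [hσt.eventually h, hct'] with y hy hy'
    obtain ⟨T, hT, hT0⟩ := hy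
    obtain ⟨S, hS⟩ := hσd y hy'
    have h1 := HasMFDerivAt.comp y hT hS
    have h2 : HasFDerivAt (f ∘ σ) (T ∘L (ContinuousLinearMap.id ℝ (E n)).prodMap
      ((ContinuousLinearMap.id ℝ (E n)).prodMap S)) y := h1.hasFDerivAt
    refine ⟨h2.differentiableAt, fun v => ?_⟩
    rw [h2.fderiv]
    exact hT0 _ rfl)
  have hτ : Filter.Tendsto (fun q : G1 n G => (q.1, q.2.1, c q.2.2)) (𝓝 p)
      (𝓝 (p.1, p.2.1, c p.2.2)) := by
    have h1 : ContinuousAt c p.2.2 := continuousAt_extChartAt p.2.2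
    have h2 : ContinuousAt (fun q : G1 n G => c q.2.2) p :=
      ContinuousAt.comp' (f := fun q : G1 n G => q.2.2) h1 (by fun_prop)
    exact (continuous_fst.continuousAt).prodMk
      ((continuous_fst.comp continuous_snd).continuousAt.prodMk h2)
  have hcs : ∀ᶠ q : G1 n G in 𝓝 p, q.2.2 ∈ c.source :=
    (continuous_snd.comp continuous_snd).continuousAt.eventually
      (extChartAt_source_mem_nhds (I := 𝓡 r) p.2.2)
  filter_upwards [hτ.eventually key, hcs] with q hq hqs
  have h1 : σ (q.1, q.2.1, c q.2.2) = q := by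
    simp only [σ, c.left_inv hqs]
  have h2 : σ (q.1, p.2.1, c p.2.2) = (q.1, p.2) := by
    simp only [σ, hc, extChartAt_to_inv]
  have h3 : f (σ (q.1, q.2.1, c q.2.2)) = f (σ (q.1, p.2.1, c p.2.2)) := hq
  rwa [h1, h2] at h3

namespace Absorption

variable (D : Absorption ι A b)

/-- The solutions of the prolonged problem are, locally, right actions. -/
theorem SolvesProlonged.exists_local (hι : IsLieSubgroup (r := r) ι)
    (hA : ContDiff ℝ ω fun x => (A x : E n →L[ℝ] E n)) {W : Set (G1 n G)} {Φ : G1 n G → G1 n G}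
    (hW : IsOpen W) (hΦ : ContMDiffOn (I1 n r) (I1 n r) ω Φ W) (h : D.SolvesProlonged Φ W)
    {p : G1 n G} (hp : p ∈ W) : ∃ (U : Set (E n)) (φ : E n → E n),
      IsOpen U ∧ p.1 ∈ U ∧ IsLocalDiffeomorphOn 𝓘(ℝ, E n) 𝓘(ℝ, E n) ω φ U ∧
      SolvesG11 ι A b φ U ∧ ∀ᶠ q in 𝓝 p, IsRightAction ι A φ q (Φ q) := by
  have hat : ∀ q ∈ W, ContMDiffAt (I1 n r) (I1 n r) ω Φ q :=
    fun q hq => hΦ.contMDiffAt (hW.mem_nhds hq)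
  have hmd : ∀ q ∈ W, MDifferentiableAt (I1 n r) (I1 n r) Φ q :=
    fun q hq => (hat q hq).mdifferentiableAt (by simp)
  have hjet : ∀ q ∈ W, ∃ z, SecondOrderEq ι A b q.1 (Φ q).1 ((Φ q).2.2⁻¹ * q.2.2) z ∧
      IsActionJet ι A b (Φ q).1 ((Φ q).2.2⁻¹ * q.2.2) z q (Φ q)
        (mfderiv (I1 n r) (I1 n r) Φ q) := by
    intro q hq
    obtain ⟨⟨k, z⟩, ⟨hz, hL⟩, -⟩ := (D.prolongedAt_iff hι q (Φ q) _).1 (h q hq)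
    have hk : (Φ q).2.2 = q.2.2 * k⁻¹ := congrArg (fun q : G1 n G => q.2.2) hL.1
    have hk' : k = (Φ q).2.2⁻¹ * q.2.2 := by
      rw [hk]
      group
    subst hk'
    exact ⟨z, hz, hL⟩
  have hconst : ∀ᶠ q in 𝓝 p, (Φ q).1 = (Φ (q.1, p.2)).1 := by
    -- The source part of the derivative is `A⁻¹hA` applied to `dx`, so it kills the vertical
    -- vectors.
    refine eventually_eq_of_mfderiv_eq_zero (r := r) (G := G) (f := fun q => (Φ q).1) ?_
    filter_upwards [hW.mem_nhds hp] with q hq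
    refine ⟨_, (hasMFDerivAt_components (hmd q hq) rfl).1, fun w hw => ?_⟩
    obtain ⟨z, -, hL⟩ := hjet q hq
    refine (A (Φ q).1).injective ((hL.2 w).1.trans ?_)
    rw [hw, map_zero, map_zero, map_zero]
  let φ : E n → E n := fun x => (Φ (x, p.2)).1
  have hs : Continuous fun x : E n => ((x, p.2) : G1 n G) := by fun_prop
  have hsm : ContMDiff 𝓘(ℝ, E n) (I1 n r) ω fun x : E n => ((x, p.2) : G1 n G) :=
    contMDiff_id.prodMk contMDiff_const
  have hφat : ∀ x, (x, p.2) ∈ W → ContDiffAt ℝ ω φ x := fun x hx =>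
    ((contMDiff_fst _).comp x ((hat _ hx).comp x (hsm x))).contDiffAt
  have hev : ∀ᶠ q in 𝓝 p, ∀ᶠ q' in 𝓝 q, q' ∈ W ∧ (q'.1, p.2) ∈ W ∧ (Φ q').1 = φ q'.1 := by
    refine Filter.Eventually.eventually_nhds ?_
    have h1 : ContinuousAt (fun q : G1 n G => ((q.1, p.2) : G1 n G)) p :=
      (hs.comp continuous_fst).continuousAt
    filter_upwards [hW.mem_nhds hp, h1.eventually (hW.mem_nhds hp), hconst] with q h1 h2 h3
    exact ⟨h1, h2, h3⟩
  have hcartan : ∀ q : G1 n G, (∀ᶠ q' in 𝓝 q, q' ∈ W ∧ (q'.1, p.2) ∈ W ∧ (Φ q').1 = φ q'.1) →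
      ∀ u, A (φ q.1) (fderiv ℝ φ q.1 u) = ι ((Φ q).2.2⁻¹ * q.2.2) (A q.1 u) := by
    intro q hq u
    obtain ⟨hqW, hqW', hqφ⟩ := hq.self_of_nhds
    have h1 := deriv_fst_of_eventuallyEq (hmd q hqW) rfl
      ((hφat _ hqW').differentiableAt (by simp)) (hq.mono fun _ h => h.2.2) (u, 0, 0)
    obtain ⟨z, -, hL⟩ := hjet q hqW
    have h2 := (hL.2 (u, 0, 0)).1
    rw [hqφ] at h2
    exact (congrArg (A (φ q.1)) h1).symm.trans h2
  have hact : ∀ᶠ q in 𝓝 p, ∀ᶠ q' in 𝓝 q, IsRightAction ι A φ q' (Φ q') := by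
    refine hev.eventually_nhds.mono fun q hq => hq.mono fun q' hq' => ?_
    obtain ⟨hqW, -, hqφ⟩ := hq'.self_of_nhds
    rw [isRightAction_iff]
    refine ⟨hqφ, (h q' hqW).1.1, ?_⟩
    rw [(cartanMatrix_eq_iff φ q'.1 _).2 (hcartan q' hq'), ← toEnd_mul, mul_inv_cancel_left]
  -- `U` consists of `x` for which everything holds on a neighbourhood of `(x, p.2)`, since the
  -- second jet of `φ` at `x` is read off from the derivative of `Φ` there.
  obtain ⟨U, hUs, hU, hpU⟩ := mem_nhds_iff.1
    ((hs.continuousAt (x := p.1)).eventually (hev.and hact))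
  have hUat : ∀ x ∈ U, ContDiffAt ℝ ω φ x := fun x hx =>
    hφat x (hUs hx).1.self_of_nhds.2.1
  refine ⟨U, φ, hU, hpU, ?_, ?_, hact.self_of_nhds⟩
  · refine isLocalDiffeomorphOn_of_injective_fderiv hU
      (fun x hx => (hUat x hx).contDiffWithinAt) fun x hx u u' huu => ?_
    have h1 := hcartan (x, p.2) (hUs hx).1
    have h2 := (h1 u).symm.trans ((congrArg (A (φ x)) huu).trans (h1 u'))
    exact (A x).injective ((ι _).injective h2)
  · intro x hx
    obtain ⟨h1, h2⟩ := hUs hx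
    have hxW : (x, p.2) ∈ W := h1.self_of_nhds.1
    obtain ⟨z, hz, hL⟩ := hjet _ hxW
    exact ⟨_, z, hasSecondJet_of_isActionJet (p := (x, p.2)) hι hA (hmd _ hxW) (hUat x hx) h2 hL,
      hz⟩

theorem solvesProlonged_of_local (hι : IsLieSubgroup (r := r) ι)
    (hA : ContDiff ℝ ω fun x => (A x : E n →L[ℝ] E n)) {W : Set (G1 n G)} {Φ : G1 n G → G1 n G}
    (hW : IsOpen W) (hΦ : ContMDiffOn (I1 n r) (I1 n r) ω Φ W)
    (h : ∀ p ∈ W, ∃ (U : Set (E n)) (φ : E n → E n),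
      IsOpen U ∧ p.1 ∈ U ∧ IsLocalDiffeomorphOn 𝓘(ℝ, E n) 𝓘(ℝ, E n) ω φ U ∧
      SolvesG11 ι A b φ U ∧ ∀ᶠ q in 𝓝 p, IsRightAction ι A φ q (Φ q)) :
    D.SolvesProlonged Φ W := by
  intro p hp
  obtain ⟨U, φ, -, hpU, hφ, hsol, hact⟩ := h p hp
  exact D.prolongedAt_of_isRightAction hι hA
    ((hΦ.contMDiffAt (hW.mem_nhds hp)).mdifferentiableAt (by simp)) hpU
    (hφ ⟨p.1, hpU⟩).contMDiffAt.contDiffAt hsol hact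

end Absorption

theorem cartanMatrix_congr {φ φ' : E n → E n} {x : E n} (h : φ =ᶠ[𝓝 x] φ') :
    cartanMatrix A φ =ᶠ[𝓝 x] cartanMatrix A φ' := by
  filter_upwards [h.eventuallyEq_nhds] with y hy
  rw [cartanMatrix, cartanMatrix, hy.fderiv_eq, hy.eq_of_nhds]

theorem HasSecondJet.congr {φ φ' : E n → E n} {x : E n} (h : φ =ᶠ[𝓝 x] φ') {k : G}
    {z : Fin r × Fin n → ℝ} (H : HasSecondJet ι A b φ x k z) : HasSecondJet ι A b φ' x k z := by
  rw [HasSecondJet, (cartanMatrix_congr h).fderiv_eq, h.fderiv_eq, h.eq_of_nhds] at H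
  exact H

/-- Analyticity and an injective derivative pass to `φ'` near `x`, and the inverse function theorem
does the rest. -/
theorem isLocalDiffeomorphAt_congr {φ φ' : E n → E n} {x : E n} (h : φ' =ᶠ[𝓝 x] φ)
    (H : IsLocalDiffeomorphAt 𝓘(ℝ, E n) 𝓘(ℝ, E n) ω φ x) :
    IsLocalDiffeomorphAt 𝓘(ℝ, E n) 𝓘(ℝ, E n) ω φ' x := by
  obtain ⟨Ψ, hx, hΨ⟩ := H
  obtain ⟨U, hUs, hU, hxU⟩ := mem_nhds_iff.1 (h.and (Ψ.open_source.mem_nhds hx))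
  have h1 : ∀ y ∈ U, IsLocalDiffeomorphAt 𝓘(ℝ, E n) 𝓘(ℝ, E n) ω φ y :=
    fun y hy => ⟨Ψ, (hUs hy).2, hΨ⟩
  have h2 : ∀ y ∈ U, φ' =ᶠ[𝓝 y] φ := fun y hy =>
    Filter.eventually_of_mem (hU.mem_nhds hy) fun y' hy' => (hUs hy').1
  refine isLocalDiffeomorphOn_of_injective_fderiv hU (fun y hy =>
    ((h1 y hy).contMDiffAt.contDiffAt.congr_of_eventuallyEq (h2 y hy)).contDiffWithinAt)
    (fun y hy => ?_) ⟨x, hxU⟩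
  rw [(h2 y hy).fderiv_eq]
  exact (fderiv_bijective_of_isLocalDiffeomorphAt (h1 y hy)).injective

namespace Absorption

variable (D : Absorption ι A b)

theorem SolvesProlonged.exists_global (hι : IsLieSubgroup (r := r) ι)
    (hA : ContDiff ℝ ω fun x => (A x : E n →L[ℝ] E n)) {W : Set (G1 n G)} {Φ : G1 n G → G1 n G}
    (hW : IsOpen W) (hconn : ∀ x, IsPreconnected {p ∈ W | p.1 = x})
    (hΦ : ContMDiffOn (I1 n r) (I1 n r) ω Φ W) (h : D.SolvesProlonged Φ W) :
    ∃ φ : E n → E n,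
        IsLocalDiffeomorphOn 𝓘(ℝ, E n) 𝓘(ℝ, E n) ω φ (Prod.fst '' W) ∧
        SolvesG11 ι A b φ (Prod.fst '' W) ∧ ∀ q ∈ W, IsRightAction ι A φ q (Φ q) := by
  have hloc := fun p (hp : p ∈ W) => SolvesProlonged.exists_local D hι hA hW hΦ h hp
  have h1 : ∀ x, ∃ y, ∀ p ∈ W, p.1 = x → (Φ p).1 = y := by
    intro x
    by_cases hx : ∃ p₀ ∈ W, p₀.1 = x
    · obtain ⟨p₀, hp₀, hx₀⟩ := hx
      refine ⟨(Φ p₀).1, fun p hp hpx => ?_⟩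
      -- Having the same image source is an equivalence relation on the fibre with open classes, so
      -- a connected fibre is a single class.
      refine (hconn x).induction₂ (fun p q => (Φ p).1 = (Φ q).1) (fun p hp => ?_)
        (fun _ _ _ _ _ _ h h' => h.trans h') (fun _ _ _ _ h => h.symm) ⟨hp, hpx⟩ ⟨hp₀, hx₀⟩
      obtain ⟨U, φ, -, -, -, -, hact⟩ := hloc p hp.1
      filter_upwards [nhdsWithin_le_nhds hact, self_mem_nhdsWithin] with q hq hqx
      rw [hq.1, hact.self_of_nhds.1, hqx.2, hp.2]
    -- Arbitrary value outside the projection of `W`.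
    · exact ⟨0, fun p hp hpx => absurd ⟨p, hp, hpx⟩ hx⟩
  choose φ hφ using h1
  have hφ' : ∀ p ∈ W, ∀ ψ : E n → E n, (∀ᶠ q in 𝓝 p, IsRightAction ι A ψ q (Φ q)) →
      φ =ᶠ[𝓝 p.1] ψ := by
    intro p hp ψ hψ
    have hs : ContinuousAt (fun x : E n => ((x, p.2) : G1 n G)) p.1 := by fun_prop
    filter_upwards [hs.eventually (hψ.and (hW.mem_nhds hp))] with x hx
    rw [← hφ x (x, p.2) hx.2 rfl]
    exact hx.1.1
  refine ⟨φ, ?_, ?_, fun q hq => ?_⟩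
  · rintro ⟨_, p, hp, rfl⟩
    obtain ⟨U, ψ, -, hpU, hψ, -, hact⟩ := hloc p hp
    exact isLocalDiffeomorphAt_congr (hφ' p hp ψ hact) (hψ ⟨p.1, hpU⟩)
  · rintro _ ⟨p, hp, rfl⟩
    obtain ⟨U, ψ, -, hpU, -, hsol, hact⟩ := hloc p hp
    obtain ⟨k, z, hz, hz'⟩ := hsol p.1 hpU
    have h2 := hφ' p hp ψ hact
    refine ⟨k, z, hz.congr h2.symm, ?_⟩
    rwa [h2.eq_of_nhds]
  · obtain ⟨U, ψ, -, -, -, -, hact⟩ := hloc q hq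
    have h2 := hφ' q hq ψ hact
    have h3 := hact.self_of_nhds
    rw [IsRightAction] at h3 ⊢
    rwa [h2.fderiv_eq, h2.eq_of_nhds]

end Absorption

end Solutions

end CartanProlongation

end

/-! ### The main theorem -/

theorem mainTheorem2 {n r : ℕ} {G : Type*} [TopologicalSpace G] [ChartedSpace (E r) G] [Group G]
    [LieGroup (𝓡 r) ω G]
    (ι : G →* (E n ≃L[ℝ] E n)) (hι : IsLieSubgroup (r := r) ι)
    (A : E n → E n ≃L[ℝ] E n) (hA : ContDiff ℝ ω fun x => (A x : E n →L[ℝ] E n))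
    (b : Module.Basis (Fin r) ℝ (GroupLieAlgebra (𝓡 r) G)) (D : Absorption ι A b) :
    -- `(gη, π)`, completed by `dX`, is a coframe on `𝒢₁`
    (∀ p : G1 n G, Function.Bijective fun w : T1 n r => (D.coframe p w, w.2.1)) ∧
    -- every fibre of `𝒢₁,₁ → 𝒢₁` is an affine space of dimension the number of parametric `z`
    (∀ (x X : E n) (g : G), ∃ S : AffineSubspace ℝ (Fin r × Fin n → ℝ),
      (∀ z, z ∈ S ↔ SecondOrderEq ι A b x X g z) ∧ (S : Set (Fin r × Fin n → ℝ)).Nonempty ∧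
        Module.finrank ℝ S.direction = D.par.card) ∧
    -- `G⁽²⁾` is abelian, with product `M(v), M(y) ↦ M(v + y)`, and parametrized by the parametric `v`
    (∀ v y, D.block v * D.block y = D.block (v + y)) ∧
    (∀ m ∈ D.G2, ∀ m' ∈ D.G2, m * m' = m' * m) ∧
    (∃ θ : Multiplicative (D.par → ℝ) ≃ₜ* D.G2, ∀ (v : D.par → ℝ) (a : D.par),
      ((θ (Multiplicative.ofAdd v) : GL (Fin n ⊕ Fin r) ℝ) :
        Matrix (Fin n ⊕ Fin r) (Fin n ⊕ Fin r) ℝ) (Sum.inr a.1.1) (Sum.inl a.1.2) = v a) ∧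
    -- equivalence of the two differential equations as sets of jets
    (∀ (p q : G1 n G) (L : T1 n r →L[ℝ] T1 n r), D.ProlongedAt p q L ↔
      ∃! hz : G × (Fin r × Fin n → ℝ),
        SecondOrderEq ι A b p.1 q.1 hz.1 hz.2 ∧ IsActionJet ι A b q.1 hz.1 hz.2 p q L) ∧
    -- the solutions of the prolonged problem are, locally, the right actions of solutions of `𝒢₁,₁`
    (∀ (W : Set (G1 n G)) (Φ : G1 n G → G1 n G), IsOpen W →
      ContMDiffOn (I1 n r) (I1 n r) ω Φ W →
      (D.SolvesProlonged Φ W ↔ ∀ p ∈ W, ∃ (U : Set (E n)) (φ : E n → E n),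
        IsOpen U ∧ p.1 ∈ U ∧ IsLocalDiffeomorphOn 𝓘(ℝ, E n) 𝓘(ℝ, E n) ω φ U ∧
        SolvesG11 ι A b φ U ∧ ∀ᶠ q in 𝓝 p, IsRightAction ι A φ q (Φ q))) ∧
    -- globally on a domain with connected fibres over the source
    (∀ (W : Set (G1 n G)) (Φ : G1 n G → G1 n G), IsOpen W →
      (∀ x, IsPreconnected {p ∈ W | p.1 = x}) →
      ContMDiffOn (I1 n r) (I1 n r) ω Φ W →
      (D.SolvesProlonged Φ W ↔ ∃ φ : E n → E n,
        IsLocalDiffeomorphOn 𝓘(ℝ, E n) 𝓘(ℝ, E n) ω φ (Prod.fst '' W) ∧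
        SolvesG11 ι A b φ (Prod.fst '' W) ∧ ∀ q ∈ W, IsRightAction ι A φ q (Φ q))) ∧
    -- every solution of `𝒢₁,₁` acts, and its action solves the prolonged problem
    (∀ (U : Set (E n)) (φ : E n → E n), IsOpen U →
      IsLocalDiffeomorphOn 𝓘(ℝ, E n) 𝓘(ℝ, E n) ω φ U → SolvesG11 ι A b φ U →
      ∃ Φ : G1 n G → G1 n G,
        IsLocalDiffeomorphOn (I1 n r) (I1 n r) ω Φ (Prod.fst ⁻¹' U) ∧
        (∀ q ∈ Prod.fst ⁻¹' U, IsRightAction ι A φ q (Φ q)) ∧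
        D.SolvesProlonged Φ (Prod.fst ⁻¹' U) ∧
        ∀ q ∈ Prod.fst ⁻¹' U, ∀ (h : G) (z : Fin r × Fin n → ℝ), HasSecondJet ι A b φ q.1 h z →
          IsActionJet ι A b (φ q.1) h z q (Φ q) (mfderiv (I1 n r) (I1 n r) Φ q)) := by
  refine ⟨D.coframe_bijective, D.exists_affineSubspace, D.block_mul, D.G2_commute,
    D.exists_parametrization, D.prolongedAt_iff hι, fun W Φ hW hΦ => ⟨fun h p hp => ?_, fun h => ?_⟩,
    fun W Φ hW hconn hΦ => ⟨fun h => ?_, ?_⟩, fun U φ hU hφ hsol => D.exists_action hι hA hU hφ hsol⟩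
  · exact Absorption.SolvesProlonged.exists_local D hι hA hW hΦ h hp
  · exact D.solvesProlonged_of_local hι hA hW hΦ h
  · exact Absorption.SolvesProlonged.exists_global D hι hA hW hconn hΦ h
  · rintro ⟨φ, hφ, hsol, hact⟩
    exact D.solvesProlonged_of_local hι hA hW hΦ fun p hp =>
      ⟨Prod.fst '' W, φ, isOpenMap_fst W hW, ⟨p, hp, rfl⟩, hφ, hsol,
        Filter.eventually_of_mem (hW.mem_nhds hp) hact⟩
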